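/- Let $\mathbb F$ be any field and $L$ any Lie algebra over $\mathbb F$ (of arbitrary dimension), with universal enveloping algebra $U(L)$. Let $\gamma_1(L)=L$, $\gamma_{i+1}(L)=[\gamma_i(L),L]$ be the lower central series, and let $\mathrm{gr}(L)=\bigoplus_{i\ge 1}\gamma_i(L)/\gamma_{i+1}(L)$ be the associated graded Lie algebra, with bracket $[x+\gamma_{i+1}(L),\,y+\gamma_{j+1}(L)]=[x,y]+\gamma_{i+j+1}(L)$ for $x\in\gamma_i(L)$, $y\in\gamma_j(L)$. Let $\omega(L)$ be the augmentation ideal of $U(L)$, i.e. the kernel of the algebra map $U(L)\to\mathbb F$ that sends every $x\in L$ to $0$; put $\omega^0(L)=U(L)$, and let $\mathrm{gr}(U(L))=\bigoplus_{n\ge 0}\omega^n(L)/\omega^{n+1}(L)$ be the associated graded algebra, with product $(y+\omega^{i+1}(L))(z+\omega^{j+1}(L))=yz+\omega^{i+j+1}(L)$ for $y\in\omega^i(L)$, $z\in\omega^j(L)$. The maps $\gamma_i(L)/\gamma_{i+1}(L)\to\omega^i(L)/\omega^{i+1}(L)$, $x+\gamma_{i+1}(L)\mapsto x+\omega^{i+1}(L)$,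 define a Lie algebra homomorphism $\mathrm{gr}(L)\to\mathrm{gr}(U(L))$; let $\phi:U(\mathrm{gr}(L))\to\mathrm{gr}(U(L))$ be the algebra homomorphism that it induces. Grade $U(\mathrm{gr}(L))$ by letting its degree-$n$ part be the span of all products $a_1\cdots a_k$ ($k\ge 0$) of homogeneous elements $a_j\in\mathrm{gr}(L)$ whose degrees add up to $n$. **Theorem.** 1. The map $\phi:U(\mathrm{gr}(L))\to\mathrm{gr}(U(L))$ is an isomorphism of graded associative algebras: the subspaces above form an algebra grading of $U(\mathrm{gr}(L))$, and $\phi$ is bijective and maps the degree-$n$ part of $U(\mathrm{gr}(L))$ onto $\omega^n(L)/\omega^{n+1}(L)$ for every $n\ge 0$. 2. Consequently, $\mathrm{gr}(L)$ and the quotients $\gamma_n(L)/\gamma_{m+n}(L)$ with $n\ge m\ge 1$ are determined by $U(L)$. That is, if $H$ is a Lie algebra over $\mathbb F$ such that $U(L)\cong U(H)$ as associative $\mathbb F$-algebras, then $\mathrm{gr}(L)\cong\mathrm{gr}(H)$ as graded Lie algebras, and $\gamma_n(L)/\gamma_{m+n}(L)\cong\gamma_n(H)/\gamma_{m+n}(H)$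 as Lie algebras for all integers $n\ge m\ge 1$. -/

import Mathlib

open DirectSum

noncomputable section

/- The commutator bracket `⁅a, b⁆ = a * b - b * a` on an associative algebra. -/
attribute [local instance] LieRing.ofAssociativeRing

namespace LieGraded

/-! ### Subquotients and bilinear maps between them -/

section Subquotient

variable {F : Type*} [Field F] {M : Type*} [AddCommGroup M] [Module F M]

/-- The quotient `P / (P ∩ P')`; it is used for `P' ≤ P`, when it is `P / P'`. -/
abbrev SubQuot (P P' : Submodule F M) : Type _ := ↥P ⧸ P'.submoduleOf P

/-- The class of `x ∈ P` in `P / P'`. -/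
def SubQuot.mk {P P' : Submodule F M} (x : M) (hx : x ∈ P) : SubQuot P P' :=
  (P'.submoduleOf P).mkQ ⟨x, hx⟩

theorem SubQuot.exists_rep {P P' : Submodule F M} (a : SubQuot P P') :
    ∃ (x : M) (hx : x ∈ P), a = SubQuot.mk x hx := by
  obtain ⟨⟨x, hx⟩, rfl⟩ := Submodule.mkQ_surjective _ a
  exact ⟨x, hx, rfl⟩

/-- A bilinear map `B` on `M` with `B(P, Q) ⊆ R`, `B(P', Q) ⊆ R'`, `B(P, Q') ⊆ R'` induces
a bilinear map `P / P' × Q / Q' → R / R'`, `(x + P', y + Q') ↦ B(x, y) + R'`. -/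
def SubQuot.bilin (B : M →ₗ[F] M →ₗ[F] M) {P P' Q Q' R R' : Submodule F M}
    (h : ∀ x ∈ P, ∀ y ∈ Q, B x y ∈ R) (h₁ : ∀ x ∈ P', ∀ y ∈ Q, B x y ∈ R')
    (h₂ : ∀ x ∈ P, ∀ y ∈ Q', B x y ∈ R') :
    SubQuot P P' →ₗ[F] SubQuot Q Q' →ₗ[F] SubQuot R R' :=
  (P'.submoduleOf P).liftQ
    { toFun := fun x => (Q'.submoduleOf Q).liftQ
        ((R'.submoduleOf R).mkQ ∘ₗ
          ((B x ∘ₗ Q.subtype).codRestrict R (fun y => h x x.2 y y.2)))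
        (by
          intro y hy
          rw [LinearMap.mem_ker, LinearMap.comp_apply, Submodule.mkQ_apply,
            Submodule.Quotient.mk_eq_zero]
          exact h₂ x x.2 y hy)
      map_add' := by
        intro x x'
        apply Submodule.linearMap_qext
        ext y
        simp only [LinearMap.comp_apply, Submodule.mkQ_apply, Submodule.liftQ_apply,
          LinearMap.add_apply, ← Submodule.Quotient.mk_add]
        congr 1
        ext
        exact LinearMap.congr_fun (map_add B (x : M) x') (y : M)
      map_smul' := by
        intro c x
        apply Submodule.linearMap_qext
        ext y
        simp only [LinearMap.comp_apply, Submodule.mkQ_apply, Submodule.liftQ_apply,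
          LinearMap.smul_apply, RingHom.id_apply, ← Submodule.Quotient.mk_smul]
        congr 1
        ext
        exact LinearMap.congr_fun (map_smul B c (x : M)) (y : M) }
    (by
      intro x hx
      rw [LinearMap.mem_ker]
      apply Submodule.linearMap_qext
      ext y
      simp only [LinearMap.coe_mk, AddHom.coe_mk, LinearMap.comp_apply, Submodule.mkQ_apply,
        Submodule.liftQ_apply, LinearMap.zero_apply]
      rw [Submodule.Quotient.mk_eq_zero]
      exact h₁ x hx y y.2)

theorem SubQuot.bilin_mk (B : M →ₗ[F] M →ₗ[F] M) {P P' Q Q' R R' : Submodule F M}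
    (h : ∀ x ∈ P, ∀ y ∈ Q, B x y ∈ R) (h₁ : ∀ x ∈ P', ∀ y ∈ Q, B x y ∈ R')
    (h₂ : ∀ x ∈ P, ∀ y ∈ Q', B x y ∈ R') (x y : M) (hx : x ∈ P) (hy : y ∈ Q) :
    SubQuot.bilin B h h₁ h₂ (SubQuot.mk x hx) (SubQuot.mk y hy)
      = SubQuot.mk (B x y) (h x hx y hy) := rfl

end Subquotient

universe u v

variable (F : Type u) [Field F] (L : Type v) [LieRing L] [LieAlgebra F L]

/-! ### The lower central series and the graded Lie algebra `gr L` -/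

/-- The lower central series in the indexing `γ₁(L) = L`, `γₙ₊₁(L) = [γₙ(L), L]`.
(The value at `n = 0` is `L` and is never used.) -/
def gamma (n : ℕ) : LieIdeal F L := LieModule.lowerCentralSeries F L L (n - 1)

theorem gamma_one : gamma F L 1 = ⊤ := rfl

theorem gamma_succ (n : ℕ) (hn : 1 ≤ n) :
    gamma F L (n + 1) = ⁅gamma F L n, (⊤ : LieIdeal F L)⁆ := by
  obtain ⟨k, rfl⟩ := Nat.exists_eq_add_of_le' hn
  rw [LieSubmodule.lie_comm]
  exact LieModule.lowerCentralSeries_succ F L L k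

theorem gamma_anti {m n : ℕ} (h : m ≤ n) : gamma F L n ≤ gamma F L m :=
  LieModule.antitone_lowerCentralSeries F L L (Nat.sub_le_sub_right h 1)

theorem lie_gamma_le (i j : ℕ) (hi : 1 ≤ i) (hj : 1 ≤ j) :
    ⁅gamma F L i, gamma F L j⁆ ≤ gamma F L (i + j) := by
  induction j, hj using Nat.le_induction generalizing i with
  | base => rw [gamma_one, ← gamma_succ F L i hi]
  | succ j hj ih =>
    rw [LieSubmodule.lie_le_iff]
    intro x hx m hm
    rw [gamma_succ F L j hj, ← LieSubmodule.mem_toSubmodule,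
      LieSubmodule.lieIdeal_oper_eq_linear_span'] at hm
    induction hm using Submodule.span_induction with
    | mem m hm =>
      obtain ⟨a, ha, b, hb, rfl⟩ := hm
      rw [leibniz_lie]
      refine add_mem ?_ ?_
      · rw [← Nat.add_assoc, gamma_succ F L (i + j) (by omega)]
        exact LieSubmodule.lie_mem_lie (ih i hi (LieSubmodule.lie_mem_lie hx ha)) hb
      · have hxb : ⁅x, b⁆ ∈ gamma F L (i + 1) := by
          rw [gamma_succ F L i hi]
          exact LieSubmodule.lie_mem_lie hx hb
        have := ih (i + 1) (by omega) (LieSubmodule.lie_mem_lie hxb ha)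
        rw [← lie_skew, show i + (j + 1) = i + 1 + j by omega]
        exact neg_mem this
    | zero => rw [lie_zero]; exact zero_mem _
    | add m m' _ _ h h' => rw [lie_add]; exact add_mem h h'
    | smul c m _ h => rw [lie_smul]; exact (gamma F L (i + (j + 1))).smul_mem c h

theorem lie_mem_gamma {i j : ℕ} (hi : 1 ≤ i) (hj : 1 ≤ j) {x y : L}
    (hx : x ∈ gamma F L i) (hy : y ∈ gamma F L j) : ⁅x, y⁆ ∈ gamma F L (i + j) :=
  lie_gamma_le F L i j hi hj (LieSubmodule.lie_mem_lie hx hy)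

theorem lie_mem_gamma_pnat {i j : ℕ+} {x y : L}
    (hx : x ∈ gamma F L i) (hy : y ∈ gamma F L j) : ⁅x, y⁆ ∈ gamma F L ((i + j : ℕ+) : ℕ) :=
  lie_mem_gamma F L i.pos j.pos hx hy

/-- The `i`-th homogeneous component `γᵢ(L) / γᵢ₊₁(L)` of `gr L`, for `i ≥ 1`. -/
def GrLieComp (i : ℕ+) : Type v :=
  SubQuot (gamma F L i).toSubmodule (gamma F L (i + 1)).toSubmodule

instance (i : ℕ+) : AddCommGroup (GrLieComp F L i) :=
  inferInstanceAs (AddCommGroup (SubQuot _ _))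

instance (i : ℕ+) : Module F (GrLieComp F L i) :=
  inferInstanceAs (Module F (SubQuot _ _))

/-- The class `x + γᵢ₊₁(L)` of `x ∈ γᵢ(L)`. -/
def GrLieComp.mk (i : ℕ+) (x : L) (hx : x ∈ gamma F L i) : GrLieComp F L i :=
  SubQuot.mk (P := (gamma F L i).toSubmodule) (P' := (gamma F L (i + 1)).toSubmodule) x hx

theorem GrLieComp.exists_rep {i : ℕ+} (a : GrLieComp F L i) :
    ∃ x hx, a = GrLieComp.mk F L i x hx :=
  SubQuot.exists_rep a

/-- The graded Lie algebra `gr L = ⨁_{i ≥ 1} γᵢ(L) / γᵢ₊₁(L)`; its bracket is defined below. -/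
abbrev GrLie : Type v := ⨁ i : ℕ+, GrLieComp F L i

namespace GrLie

/-- The inclusion of the `i`-th component `γᵢ(L) / γᵢ₊₁(L)` in `gr L`. -/
def incl (i : ℕ+) : GrLieComp F L i →ₗ[F] GrLie F L := DirectSum.lof F ℕ+ (GrLieComp F L) i

/-- The homogeneous element `x + γᵢ₊₁(L)` of `gr L`, for `x ∈ γᵢ(L)`. -/
def of (i : ℕ+) (x : L) (hx : x ∈ gamma F L i) : GrLie F L :=
  incl F L i (GrLieComp.mk F L i x hx)

/-- The bracket `γᵢ/γᵢ₊₁ × γⱼ/γⱼ₊₁ → γᵢ₊ⱼ/γᵢ₊ⱼ₊₁`,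
`[x + γᵢ₊₁, y + γⱼ₊₁] = [x, y] + γᵢ₊ⱼ₊₁`. -/
def compBracket (i j : ℕ+) :
    GrLieComp F L i →ₗ[F] GrLieComp F L j →ₗ[F] GrLieComp F L (i + j) :=
  SubQuot.bilin (LieModule.toEnd F L L : L →ₗ[F] Module.End F L)
    (fun _ hx _ hy => lie_mem_gamma F L i.pos j.pos hx hy)
    (fun x hx y hy => by
      have := lie_mem_gamma F L (Nat.le_add_left 1 i) j.pos hx hy
      rwa [Nat.add_right_comm] at this)
    (fun _ hx _ hy => lie_mem_gamma F L i.pos (Nat.le_add_left 1 j) hx hy)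

/-- The bracket of `gr L`, the bilinear extension of the brackets between components. -/
def bracket : GrLie F L →ₗ[F] GrLie F L →ₗ[F] GrLie F L :=
  DirectSum.toModule F ℕ+ _ fun i =>
    (DirectSum.toModule F ℕ+ _ fun j =>
      ((compBracket F L i j).compr₂ (incl F L (i + j))).flip).flip

theorem ext_of {N : Type*} [AddCommGroup N] [Module F N] {f g : GrLie F L →ₗ[F] N}
    (h : ∀ i x hx, f (of F L i x hx) = g (of F L i x hx)) : f = g := by
  apply DirectSum.linearMap_ext
  intro i
  ext a
  obtain ⟨x, hx, rfl⟩ := GrLieComp.exists_rep F L a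
  exact h i x hx

theorem induction_of {p : GrLie F L → Prop} (x : GrLie F L) (h0 : p 0)
    (hof : ∀ i x hx, p (of F L i x hx)) (hadd : ∀ x y, p x → p y → p (x + y)) : p x := by
  refine DirectSum.induction_on (motive := p) x h0 (fun i a => ?_) hadd
  obtain ⟨x, hx, rfl⟩ := GrLieComp.exists_rep F L a
  exact hof i x hx

theorem of_congr {i j : ℕ+} {x y : L} (hij : i = j) (hxy : x = y) (hx : x ∈ gamma F L i)
    (hy : y ∈ gamma F L j) : of F L i x hx = of F L j y hy := by
  subst hij hxy
  rfl

theorem of_add (i : ℕ+) (x y : L) (hx : x ∈ gamma F L i) (hy : y ∈ gamma F L i) :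
    of F L i (x + y) (add_mem hx hy) = of F L i x hx + of F L i y hy :=
  map_add (incl F L i) (GrLieComp.mk F L i x hx)
    (GrLieComp.mk F L i y hy)

theorem of_neg (i : ℕ+) (x : L) (hx : x ∈ gamma F L i) :
    of F L i (-x) (neg_mem hx) = - of F L i x hx :=
  map_neg (incl F L i) (GrLieComp.mk F L i x hx)

theorem of_zero (i : ℕ+) : of F L i 0 (zero_mem _) = 0 :=
  map_zero (incl F L i)

theorem bracket_of (i j : ℕ+) (x y : L) (hx : x ∈ gamma F L i) (hy : y ∈ gamma F L j) :
    bracket F L (of F L i x hx) (of F L j y hy) =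
      of F L (i + j) ⁅x, y⁆ (lie_mem_gamma_pnat F L hx hy) := by
  unfold bracket of incl
  rw [DirectSum.toModule_lof, LinearMap.flip_apply, DirectSum.toModule_lof]
  rfl

theorem bracket_skew (x y : GrLie F L) : bracket F L y x = - bracket F L x y := by
  suffices (bracket F L).flip = - bracket F L from
    LinearMap.congr_fun (LinearMap.congr_fun this x) y
  refine ext_of F L fun i x hx => ext_of F L fun j y hy => ?_
  rw [LinearMap.flip_apply, LinearMap.neg_apply, LinearMap.neg_apply, bracket_of, bracket_of,
    ← of_neg]
  exact of_congr F L (add_comm j i) (lie_skew y x).symm _ _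

theorem bracket_self (x : GrLie F L) : bracket F L x x = 0 := by
  induction x using induction_of with
  | h0 => simp
  | hof i x hx =>
    rw [bracket_of, ← of_zero F L (i + i)]
    exact of_congr F L rfl (lie_self x) _ _
  | hadd x y hx hy =>
    rw [map_add, map_add, LinearMap.add_apply, LinearMap.add_apply, hx, hy, bracket_skew F L x y]
    abel

theorem bracket_leibniz (x y z : GrLie F L) :
    bracket F L x (bracket F L y z) =
      bracket F L (bracket F L x y) z + bracket F L y (bracket F L x z) := by
  induction x using induction_of with
  | h0 => simp
  | hadd x x' hx hx' => simp only [map_add, LinearMap.add_apply, hx, hx']; abel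
  | hof i x hx =>
  induction y using induction_of with
  | h0 => simp
  | hadd y y' hy hy' => simp only [map_add, LinearMap.add_apply, hy, hy']; abel
  | hof j y hy =>
  induction z using induction_of with
  | h0 => simp
  | hadd z z' hz hz' => simp only [map_add, hz, hz']; abel
  | hof k z hz =>
    simp only [bracket_of]
    have hA : ⁅⁅x, y⁆, z⁆ ∈ gamma F L ((i + (j + k) : ℕ+) : ℕ) := by
      rw [← add_assoc]
      exact lie_mem_gamma_pnat F L (lie_mem_gamma_pnat F L hx hy) hz
    have hB : ⁅y, ⁅x, z⁆⁆ ∈ gamma F L ((i + (j + k) : ℕ+) : ℕ) := by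
      rw [add_left_comm]
      exact lie_mem_gamma_pnat F L hy (lie_mem_gamma_pnat F L hx hz)
    rw [of_congr F L (add_assoc i j k) rfl _ hA, of_congr F L (add_left_comm j i k) rfl _ hB,
      ← of_add]
    exact of_congr F L rfl (leibniz_lie x y z) _ _

instance : LieRing (GrLie F L) where
  bracket x y := bracket F L x y
  add_lie x y z := by simp
  lie_add x y z := by simp
  lie_self := bracket_self F L
  leibniz_lie := bracket_leibniz F L

instance : LieAlgebra F (GrLie F L) where
  lie_smul c x y := map_smul (bracket F L x) c y

theorem of_lie_of (i j : ℕ+) (x y : L) (hx : x ∈ gamma F L i) (hy : y ∈ gamma F L j) :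
    ⁅of F L i x hx, of F L j y hy⁆ =
      of F L (i + j) ⁅x, y⁆ (lie_mem_gamma_pnat F L hx hy) :=
  bracket_of F L i j x y hx hy

end GrLie

/-! ### The augmentation ideal and the graded algebra `gr U(L)` -/

/-- The augmentation map `ε : U(L) → F`, the algebra map with `ε(x) = 0` for `x ∈ L`. -/
def augmentation : UniversalEnvelopingAlgebra F L →ₐ[F] F :=
  UniversalEnvelopingAlgebra.lift F (0 : L →ₗ⁅F⁆ F)

/-- The augmentation ideal `ω(L) = ker ε`. -/
def omega : Ideal (UniversalEnvelopingAlgebra F L) := RingHom.ker (augmentation F L)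

instance : (omega F L).IsTwoSided := inferInstanceAs (RingHom.ker (augmentation F L)).IsTwoSided

/-- The power `ωⁿ(L)` of the augmentation ideal, as a subspace of `U(L)`; `ω⁰(L) = U(L)`. -/
def omegaPow (n : ℕ) : Submodule F (UniversalEnvelopingAlgebra F L) :=
  (omega F L ^ n).restrictScalars F

theorem one_mem_omegaPow_zero : (1 : UniversalEnvelopingAlgebra F L) ∈ omegaPow F L 0 := by
  rw [omegaPow, Submodule.restrictScalars_mem, Submodule.pow_zero, Ideal.one_eq_top]
  exact Submodule.mem_top

theorem mul_mem_omegaPow {i j : ℕ} {x y : UniversalEnvelopingAlgebra F L}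
    (hx : x ∈ omegaPow F L i) (hy : y ∈ omegaPow F L j) : x * y ∈ omegaPow F L (i + j) := by
  simp only [omegaPow, Submodule.restrictScalars_mem] at *
  rw [Ideal.IsTwoSided.pow_add]
  exact Ideal.mul_mem_mul hx hy

/-- The `n`-th homogeneous component `ωⁿ(L) / ωⁿ⁺¹(L)` of `gr U(L)`. -/
def GrEnvComp (n : ℕ) : Type (max u v) :=
  SubQuot (omegaPow F L n) (omegaPow F L (n + 1))

namespace GrEnvComp

instance (n : ℕ) : AddCommGroup (GrEnvComp F L n) :=
  inferInstanceAs (AddCommGroup (SubQuot _ _))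

instance (n : ℕ) : Module F (GrEnvComp F L n) :=
  inferInstanceAs (Module F (SubQuot _ _))

/-- The class `x + ωⁿ⁺¹(L)` of `x ∈ ωⁿ(L)`. -/
def mk (n : ℕ) (x : UniversalEnvelopingAlgebra F L) (hx : x ∈ omegaPow F L n) :
    GrEnvComp F L n :=
  SubQuot.mk (P := omegaPow F L n) (P' := omegaPow F L (n + 1)) x hx

theorem exists_rep {n : ℕ} (a : GrEnvComp F L n) : ∃ x hx, a = mk F L n x hx :=
  SubQuot.exists_rep a

/-- The product `(y + ωⁱ⁺¹)(z + ωʲ⁺¹) = yz + ωⁱ⁺ʲ⁺¹`. -/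
def mul (i j : ℕ) : GrEnvComp F L i →ₗ[F] GrEnvComp F L j →ₗ[F] GrEnvComp F L (i + j) :=
  SubQuot.bilin (LinearMap.mul F (UniversalEnvelopingAlgebra F L))
    (fun x hx y hy => mul_mem_omegaPow F L hx hy)
    (fun x hx y hy => by
      have : x * y ∈ omegaPow F L (i + 1 + j) := mul_mem_omegaPow F L hx hy
      rwa [Nat.add_right_comm] at this)
    (fun x hx y hy => show x * y ∈ omegaPow F L (i + (j + 1)) from mul_mem_omegaPow F L hx hy)

instance : GradedMonoid.GMul (GrEnvComp F L) where
  mul a b := mul F L _ _ a b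

instance : GradedMonoid.GOne (GrEnvComp F L) where
  one := mk F L 0 1 (one_mem_omegaPow_zero F L)

theorem gmk_mul (i j : ℕ) (x y : UniversalEnvelopingAlgebra F L) (hx : x ∈ omegaPow F L i)
    (hy : y ∈ omegaPow F L j) :
    (GradedMonoid.mk i (mk F L i x hx) * GradedMonoid.mk j (mk F L j y hy) :
      GradedMonoid (GrEnvComp F L)) =
      GradedMonoid.mk (i + j) (mk F L (i + j) (x * y) (mul_mem_omegaPow F L hx hy)) := rfl

theorem gmk_congr {i j : ℕ} {x y : UniversalEnvelopingAlgebra F L} (hij : i = j) (hxy : x = y)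
    (hx : x ∈ omegaPow F L i) (hy : y ∈ omegaPow F L j) :
    (GradedMonoid.mk i (mk F L i x hx) : GradedMonoid (GrEnvComp F L)) =
      GradedMonoid.mk j (mk F L j y hy) := by
  subst hij hxy
  rfl

instance : DirectSum.GRing (GrEnvComp F L) where
  mul_zero a := map_zero _
  zero_mul b := LinearMap.map_zero₂ _ _
  mul_add a b c := map_add _ _ _
  add_mul a b c := LinearMap.map_add₂ _ _ _ _
  one_mul := by
    rintro ⟨i, a⟩
    obtain ⟨x, hx, rfl⟩ := exists_rep F L a
    exact (gmk_mul F L 0 i 1 x _ hx).trans (gmk_congr F L (zero_add i) (one_mul x) _ _)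
  mul_one := by
    rintro ⟨i, a⟩
    obtain ⟨x, hx, rfl⟩ := exists_rep F L a
    exact (gmk_mul F L i 0 x 1 hx _).trans (gmk_congr F L (add_zero i) (mul_one x) _ _)
  mul_assoc := by
    rintro ⟨i, a⟩ ⟨j, b⟩ ⟨k, c⟩
    obtain ⟨x, hx, rfl⟩ := exists_rep F L a
    obtain ⟨y, hy, rfl⟩ := exists_rep F L b
    obtain ⟨z, hz, rfl⟩ := exists_rep F L c
    refine (gmk_mul F L (i + j) k _ z _ hz).trans
      (Eq.trans ?_ (gmk_mul F L i (j + k) x _ hx _).symm)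
    exact gmk_congr F L (add_assoc i j k) (mul_assoc x y z) _ _
  natCast n := n • mk F L 0 1 (one_mem_omegaPow_zero F L)
  natCast_zero := zero_nsmul _
  natCast_succ n := succ_nsmul _ _
  intCast n := n • mk F L 0 1 (one_mem_omegaPow_zero F L)
  intCast_ofNat n := natCast_zsmul _ _
  intCast_negSucc_ofNat n := negSucc_zsmul _ _

theorem gmk_algebraMap_mul (c : F) (i : ℕ) (x : UniversalEnvelopingAlgebra F L)
    (hx : x ∈ omegaPow F L i) :
    (GradedMonoid.mk 0 (c • mk F L 0 1 (one_mem_omegaPow_zero F L)) *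
      GradedMonoid.mk i (mk F L i x hx) : GradedMonoid (GrEnvComp F L)) =
      GradedMonoid.mk i (mk F L i (c • x) (Submodule.smul_mem _ c hx)) := by
  refine (gmk_mul F L 0 i (c • 1) x (Submodule.smul_mem _ c (one_mem_omegaPow_zero F L)) hx).trans
    (gmk_congr F L (zero_add i) ?_ _ _)
  rw [smul_mul_assoc, one_mul]

theorem gmk_mul_algebraMap (c : F) (i : ℕ) (x : UniversalEnvelopingAlgebra F L)
    (hx : x ∈ omegaPow F L i) :
    (GradedMonoid.mk i (mk F L i x hx) *
      GradedMonoid.mk 0 (c • mk F L 0 1 (one_mem_omegaPow_zero F L)) :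
        GradedMonoid (GrEnvComp F L)) =
      GradedMonoid.mk i (mk F L i (c • x) (Submodule.smul_mem _ c hx)) := by
  refine (gmk_mul F L i 0 x (c • 1) hx (Submodule.smul_mem _ c (one_mem_omegaPow_zero F L))).trans
    (gmk_congr F L (add_zero i) ?_ _ _)
  rw [mul_smul_comm, mul_one]

instance : DirectSum.GAlgebra F (GrEnvComp F L) where
  toFun :=
    { toFun := fun c => c • mk F L 0 1 (one_mem_omegaPow_zero F L)
      map_zero' := zero_smul _ _
      map_add' := fun c d => add_smul c d _ }
  map_one := one_smul _ _
  map_mul c d := by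
    refine Eq.trans ?_ (gmk_algebraMap_mul F L c 0 (d • 1)
      (Submodule.smul_mem _ d (one_mem_omegaPow_zero F L))).symm
    exact congrArg (GradedMonoid.mk 0) (mul_smul c d _)
  commutes := by
    rintro c ⟨i, a⟩
    obtain ⟨x, hx, rfl⟩ := exists_rep F L a
    exact (gmk_algebraMap_mul F L c i x hx).trans (gmk_mul_algebraMap F L c i x hx).symm
  smul_def := by
    rintro c ⟨i, a⟩
    obtain ⟨x, hx, rfl⟩ := exists_rep F L a
    exact (gmk_algebraMap_mul F L c i x hx).symm

end GrEnvComp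

/-- The graded associative algebra `gr U(L) = ⨁_{n ≥ 0} ωⁿ(L) / ωⁿ⁺¹(L)`. -/
abbrev GrEnv : Type (max u v) := ⨁ n : ℕ, GrEnvComp F L n

/-- The homogeneous element `x + ωⁿ⁺¹(L)` of `gr U(L)`, for `x ∈ ωⁿ(L)`. -/
def GrEnv.of (n : ℕ) (x : UniversalEnvelopingAlgebra F L) (hx : x ∈ omegaPow F L n) :
    GrEnv F L :=
  DirectSum.lof F ℕ (GrEnvComp F L) n (GrEnvComp.mk F L n x hx)

theorem GrEnv.of_mul_of (i j : ℕ) (x y : UniversalEnvelopingAlgebra F L)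
    (hx : x ∈ omegaPow F L i) (hy : y ∈ omegaPow F L j) :
    GrEnv.of F L i x hx * GrEnv.of F L j y hy =
      GrEnv.of F L (i + j) (x * y) (mul_mem_omegaPow F L hx hy) :=
  DirectSum.of_mul_of _ _

theorem GrEnv.of_sub (n : ℕ) (x y : UniversalEnvelopingAlgebra F L)
    (hx : x ∈ omegaPow F L n) (hy : y ∈ omegaPow F L n) :
    GrEnv.of F L n (x - y) (sub_mem hx hy) = GrEnv.of F L n x hx - GrEnv.of F L n y hy :=
  map_sub (DirectSum.lof F ℕ (GrEnvComp F L) n) (GrEnvComp.mk F L n x hx)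
    (GrEnvComp.mk F L n y hy)

theorem GrEnv.of_congr {i j : ℕ} {x y : UniversalEnvelopingAlgebra F L} (hij : i = j)
    (hxy : x = y) (hx : x ∈ omegaPow F L i) (hy : y ∈ omegaPow F L j) :
    GrEnv.of F L i x hx = GrEnv.of F L j y hy := by
  subst hij hxy
  rfl

/-! ### The natural map `φ : U(gr L) → gr U(L)` -/

theorem ι_mem_omegaPow {n : ℕ} (hn : 1 ≤ n) {x : L} (hx : x ∈ gamma F L n) :
    UniversalEnvelopingAlgebra.ι F x ∈ omegaPow F L n := by
  induction n, hn using Nat.le_induction generalizing x with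
  | base =>
    rw [omegaPow, Submodule.pow_one, Submodule.restrictScalars_mem, omega, RingHom.mem_ker, augmentation]
    exact UniversalEnvelopingAlgebra.lift_ι_apply F (0 : L →ₗ⁅F⁆ F) x
  | succ n hn ih =>
    have h1 : ∀ b : L, UniversalEnvelopingAlgebra.ι F b ∈ omegaPow F L 1 := fun b => by
      rw [omegaPow, Submodule.pow_one, Submodule.restrictScalars_mem, omega, RingHom.mem_ker, augmentation]
      exact UniversalEnvelopingAlgebra.lift_ι_apply F (0 : L →ₗ⁅F⁆ F) b
    rw [gamma_succ F L n hn, ← LieSubmodule.mem_toSubmodule,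
      LieSubmodule.lieIdeal_oper_eq_linear_span'] at hx
    induction hx using Submodule.span_induction with
    | mem x hx =>
      obtain ⟨a, ha, b, -, rfl⟩ := hx
      rw [LieHom.map_lie, LieRing.of_associative_ring_bracket]
      refine sub_mem (mul_mem_omegaPow F L (ih ha) (h1 b)) ?_
      rw [add_comm]
      exact mul_mem_omegaPow F L (h1 b) (ih ha)
    | zero => rw [map_zero]; exact zero_mem _
    | add x y _ _ h h' => rw [map_add]; exact add_mem h h'
    | smul c x _ h => rw [map_smul]; exact Submodule.smul_mem _ c h

/-- The linear map `γᵢ/γᵢ₊₁ → ωⁱ/ωⁱ⁺¹`, `x + γᵢ₊₁(L) ↦ x + ωⁱ⁺¹(L)`. -/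
def compMap (i : ℕ+) : GrLieComp F L i →ₗ[F] GrEnvComp F L i :=
  Submodule.mapQ ((gamma F L (i + 1)).toSubmodule.submoduleOf (gamma F L i).toSubmodule)
    ((omegaPow F L (i + 1)).submoduleOf (omegaPow F L i))
    ((UniversalEnvelopingAlgebra.ι F : L →ₗ⁅F⁆ _).toLinearMap.restrict
      (fun _ hx => ι_mem_omegaPow F L i.pos hx))
    (fun _ hx => ι_mem_omegaPow F L (Nat.le_add_left 1 i) hx)

/-- The linear map `gr L → gr U(L)` assembled from the maps `γᵢ/γᵢ₊₁ → ωⁱ/ωⁱ⁺¹`. -/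
def grMap : GrLie F L →ₗ[F] GrEnv F L :=
  DirectSum.toModule F ℕ+ _ fun i => DirectSum.lof F ℕ (GrEnvComp F L) i ∘ₗ compMap F L i

theorem grMap_of (i : ℕ+) (x : L) (hx : x ∈ gamma F L i) :
    grMap F L (GrLie.of F L i x hx) =
      GrEnv.of F L i (UniversalEnvelopingAlgebra.ι F x) (ι_mem_omegaPow F L i.pos hx) := by
  unfold grMap GrLie.of GrLie.incl
  rw [DirectSum.toModule_lof]
  rfl

theorem grMap_lie (x y : GrLie F L) : grMap F L ⁅x, y⁆ = ⁅grMap F L x, grMap F L y⁆ := by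
  induction x using GrLie.induction_of with
  | h0 => simp
  | hadd x x' hx hx' => simp only [add_lie, map_add, hx, hx']
  | hof i x hx =>
  induction y using GrLie.induction_of with
  | h0 => simp
  | hadd y y' hy hy' => simp only [lie_add, map_add, hy, hy']
  | hof j y hy =>
    rw [GrLie.of_lie_of, grMap_of, grMap_of, grMap_of, LieRing.of_associative_ring_bracket,
      GrEnv.of_mul_of, GrEnv.of_mul_of]
    have hji : UniversalEnvelopingAlgebra.ι F y * UniversalEnvelopingAlgebra.ι F x ∈
        omegaPow F L ((i + j : ℕ+) : ℕ) := by
      rw [add_comm]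
      exact mul_mem_omegaPow F L (ι_mem_omegaPow F L j.pos hy) (ι_mem_omegaPow F L i.pos hx)
    have hij : UniversalEnvelopingAlgebra.ι F x * UniversalEnvelopingAlgebra.ι F y ∈
        omegaPow F L ((i + j : ℕ+) : ℕ) :=
      mul_mem_omegaPow F L (ι_mem_omegaPow F L i.pos hx) (ι_mem_omegaPow F L j.pos hy)
    rw [GrEnv.of_congr F L (add_comm (j : ℕ) i) rfl _ hji]
    refine Eq.trans ?_ (GrEnv.of_sub F L ((i + j : ℕ+) : ℕ) _ _ hij hji)
    exact GrEnv.of_congr F L rfl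
      (by rw [LieHom.map_lie, LieRing.of_associative_ring_bracket]) _ _

/-- The Lie algebra homomorphism `gr L → gr U(L)`, `x + γᵢ₊₁(L) ↦ x + ωⁱ⁺¹(L)`. -/
def grLieHom : GrLie F L →ₗ⁅F⁆ GrEnv F L :=
  { grMap F L with map_lie' := fun {x y} => grMap_lie F L x y }

/-- The natural algebra map `φ : U(gr L) → gr U(L)` induced by `gr L → gr U(L)`. -/
def phi : UniversalEnvelopingAlgebra F (GrLie F L) →ₐ[F] GrEnv F L :=
  UniversalEnvelopingAlgebra.lift F (grLieHom F L)

theorem phi_ι_of (i : ℕ+) (x : L) (hx : x ∈ gamma F L i) :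
    phi F L (UniversalEnvelopingAlgebra.ι F (GrLie.of F L i x hx)) =
      GrEnv.of F L i (UniversalEnvelopingAlgebra.ι F x) (ι_mem_omegaPow F L i.pos hx) :=
  (UniversalEnvelopingAlgebra.lift_ι_apply F (grLieHom F L) _).trans (grMap_of F L i x hx)

/-! ### Gradings and invariants -/

/-- The degree-`i` part of `gr L`, as a subspace, for `i ≥ 1`. -/
def GrLie.degree (i : ℕ+) : Submodule F (GrLie F L) := LinearMap.range (GrLie.incl F L i)

/-- The degree-`n` part of `gr U(L)`, as a subspace. -/
def GrEnv.degree (n : ℕ) : Submodule F (GrEnv F L) :=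
  LinearMap.range (DirectSum.lof F ℕ (GrEnvComp F L) n)

/-- The degree-`n` part of `U(gr L)` for the grading induced by that of `gr L`: the span of the
products `a₁ ⋯ aₖ` (`k ≥ 0`) of homogeneous elements `aⱼ ∈ gr L` whose degrees add up to `n`. -/
def envDegree (n : ℕ) : Submodule F (UniversalEnvelopingAlgebra F (GrLie F L)) :=
  Submodule.span F
    {u | ∃ l : List (Σ i : ℕ+, GrLieComp F L i), (l.map fun a => (a.1 : ℕ)).sum = n ∧
      u = (l.map fun a => UniversalEnvelopingAlgebra.ι F (GrLie.incl F L a.1 a.2)).prod}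

/-- The Lie algebra `γₙ(L) / γₖ(L)`, for `n ≤ k`. -/
abbrev GammaQuot (n k : ℕ) : Type v :=
  ↥(gamma F L n) ⧸ (gamma F L k).comap (gamma F L n).incl

end LieGraded

end

/-! The crux is that `φ` is injective. Let `L` act on the Poincaré–Birkhoff–Witt module, which is
free on the monomials `z_M` in an ordered basis. For fixed `n`, choose the basis adapted to `γ₁ ⊇ γ₂
⊇ ⋯ ⊇ γₙ₊₁`: a basis vector has weight `i` if `γᵢ` is the last of these terms that contains it, and
a monomial has the sum of the weights of its factors. Since `[γᵢ, γⱼ] ⊆ γᵢ₊ⱼ`, an element of `γᵢ`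
raises weights by at least `i`, up to the bound `n + 1`. Hence `ωⁿ⁺¹` sends `z_∅` to weight at least
`n + 1` (`envAct_omegaPow_mem_wtGE`).

Now send each monomial of weight `n` to the sorted product, in `U(gr L)`, of the classes of its
factors, and all other monomials to `0`. This leading part turns the action of `x ∈ γᵢ` into left
multiplication by the class of `x` (`lead_act`), because the classes satisfy in `U(gr L)` the
commutation relations by which the action was defined. So `u ↦ lead (u · z_∅)` kills `ωⁿ⁺¹` and
sends a product of elements `xⱼ ∈ γ_{iⱼ}` with `∑ iⱼ = n` to the product of their classes
(`exists_symbol`). These maps assemble to a left inverse of `φ`.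

Surjectivity holds because `ω = L + ω²`, so `gr U(L)` is generated in degree one. The grading of
`U(gr L)` is then pulled back from `gr U(L)` along `φ`.

For the second part, an isomorphism `U(L) ≅ U(H)` can be corrected by a character of `L` so that it
respects augmentations, and hence the powers of `ω`. Injectivity of `φ` and of `gr L → U(gr L)`
gives `γᵢ ∩ ωⁱ⁺¹ = γᵢ₊₁`, so `gr L` can be read off inside `gr U(L)`. Finally `γₙ/γₘ₊ₙ` is abelian
for `m ≤ n`, so only its dimension matters, and the components of `gr L` determine that. -/

namespace LieGraded

attribute [local instance] LieRing.ofAssociativeRing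

universe u v v'

/-! ### The Poincaré–Birkhoff–Witt module -/

section PBW

open Finsupp

variable {R : Type*} [CommRing R] {I : Type*}

/-- The monomial `z_M` in the free module on the multisets of `I`. -/
noncomputable def mon (R : Type*) [CommRing R] {I : Type*} (M : Multiset I) : Multiset I →₀ R :=
  Finsupp.single M 1

theorem linearCombination_mon {N : Type*} [AddCommGroup N] [Module R N] (v : Multiset I → N)
    (M : Multiset I) : Finsupp.linearCombination R v (mon R M) = v M := by
  rw [mon, Finsupp.linearCombination_single, one_smul]

theorem mon_mem_supported {A : Set (Multiset I)} {M : Multiset I} (h : M ∈ A) :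
    mon R M ∈ supported R R A :=
  single_mem_supported R _ h

theorem map_mem_of_mem_supported {N : Type*} [AddCommGroup N] [Module R N]
    {A : Set (Multiset I)} {Q : Submodule R N} (g : (Multiset I →₀ R) →ₗ[R] N)
    (h : ∀ M ∈ A, g (mon R M) ∈ Q) {s : Multiset I →₀ R} (hs : s ∈ supported R R A) :
    g s ∈ Q := by
  rw [supported_eq_span_single] at hs
  have : Submodule.span R ((fun i => single i (1 : R)) '' A) ≤ Q.comap g := by
    rw [Submodule.span_le]
    rintro _ ⟨M, hM, rfl⟩
    exact h M hM
  exact this hs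

theorem eq_of_mem_supported {N : Type*} [AddCommGroup N] [Module R N]
    {A : Set (Multiset I)} (g g' : (Multiset I →₀ R) →ₗ[R] N)
    (h : ∀ M ∈ A, g (mon R M) = g' (mon R M)) {s : Multiset I →₀ R}
    (hs : s ∈ supported R R A) : g s = g' s := by
  have := map_mem_of_mem_supported (Q := ⊥) (g - g')
    (fun M hM => by simp [h M hM]) hs
  simpa [sub_eq_zero] using this

theorem linearMap_ext_mon {N : Type*} [AddCommGroup N] [Module R N]
    {g g' : (Multiset I →₀ R) →ₗ[R] N} (h : ∀ M, g (mon R M) = g' (mon R M)) : g = g' :=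
  Finsupp.lhom_ext' fun M => LinearMap.ext_ring (h M)

variable {L : Type*} [LieRing L] [LieAlgebra R L] (b : Module.Basis I R L)

theorem basis_induction {Q : L → Prop} (h : ∀ a, Q (b a)) (h0 : Q 0)
    (hadd : ∀ x y, Q x → Q y → Q (x + y)) (hsmul : ∀ (c : R) x, Q x → Q (c • x)) (x : L) : Q x := by
  have hx : x ∈ Submodule.span R (Set.range b) := by rw [b.span_eq]; trivial
  induction hx using Submodule.span_induction with
  | mem x hx => obtain ⟨a, rfl⟩ := hx; exact h a
  | zero => exact h0
  | add x y _ _ hx hy => exact hadd x y hx hy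
  | smul c x _ hx => exact hsmul c x hx

/-- The span of the monomials of degree at most `k`. -/
noncomputable def degLE (R : Type*) [CommRing R] (I : Type*) (k : ℕ) :
    Submodule R (Multiset I →₀ R) :=
  supported R R {M | M.card ≤ k}

theorem degLE_mono {k l : ℕ} (h : k ≤ l) : degLE R I k ≤ degLE R I l :=
  supported_mono fun _ hM => le_trans hM h

theorem mon_mem_degLE {k : ℕ} {M : Multiset I} (h : M.card ≤ k) : mon R M ∈ degLE R I k :=
  mon_mem_supported h

variable [LinearOrder I]

/-- One step of the recursion for the action of a basis element on a sorted monomial. -/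
noncomputable def actStepMon (f : L →ₗ[R] Module.End R (Multiset I →₀ R)) (a : I) :
    List I → (Multiset I →₀ R)
  | [] => mon R {a}
  | c :: t => mon R (a ::ₘ c ::ₘ (t : Multiset I)) + if a ≤ c then 0 else
      f (b c) (f (b a) (mon R t) - mon R (a ::ₘ (t : Multiset I))) + f ⁅b a, b c⁆ (mon R t)

/-- The action of `L` on the monomials of degree less than `m`. -/
noncomputable def actLevel : ℕ → L →ₗ[R] Module.End R (Multiset I →₀ R)
  -- Level `m` is meaningful only in degrees below `m`; at level 0 there are none, so any value
  -- would do.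
  | 0 => 0
  | m + 1 => b.constr R fun a =>
      Finsupp.linearCombination R fun M => actStepMon b (actLevel m) a (M.sort (· ≤ ·))

theorem actLevel_succ (m : ℕ) (a : I) (M : Multiset I) :
    actLevel b (m + 1) (b a) (mon R M) = actStepMon b (actLevel b m) a (M.sort (· ≤ ·)) := by
  rw [actLevel, Module.Basis.constr_basis, linearCombination_mon]

theorem sort_cons_cases (M : Multiset I) :
    M = 0 ∨ ∃ c T, M = c ::ₘ T ∧ (∀ d ∈ T, c ≤ d) ∧
      M.sort (· ≤ ·) = c :: T.sort (· ≤ ·) := by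
  rcases h : M.sort (· ≤ ·) with _ | ⟨c, t⟩
  · left
    rw [← Multiset.sort_eq M (· ≤ ·), h, Multiset.coe_nil]
  · right
    have hM : M = c ::ₘ (t : Multiset I) := by
      rw [← Multiset.sort_eq M (· ≤ ·), h, Multiset.cons_coe]
    have hs : (c :: t).Pairwise (· ≤ ·) := h ▸ Multiset.pairwise_sort M (· ≤ ·)
    have hct : ∀ d ∈ (t : Multiset I), c ≤ d := (List.pairwise_cons.1 hs).1
    refine ⟨c, t, hM, hct, ?_⟩
    rw [← h, hM, Multiset.sort_cons (r := (· ≤ ·)) _ _ hct]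

theorem actStepMon_cons (f : L →ₗ[R] Module.End R (Multiset I →₀ R)) (a c : I)
    (T : Multiset I) :
    actStepMon b f a (c :: T.sort (· ≤ ·)) = mon R (a ::ₘ c ::ₘ T) + if a ≤ c then 0 else
      f (b c) (f (b a) (mon R T) - mon R (a ::ₘ T)) + f ⁅b a, b c⁆ (mon R T) := by
  rw [actStepMon, Multiset.sort_eq]

/-- This makes the recursion close: in the rule for `z_{cT}` the correction `a · z_T - z_{aT}` has
degree at most `|T|`, so `c` is applied to it within the range where the previous level is
meaningful. -/
theorem actLevel_sub_mem (m : ℕ) (a : I) (M : Multiset I) (hM : M.card < m) :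
    actLevel b m (b a) (mon R M) - mon R (a ::ₘ M) ∈ degLE R I M.card := by
  induction m generalizing a M with
  | zero => omega
  | succ m ih =>
    rw [actLevel_succ]
    have key : ∀ (T : Multiset I), T.card < m → ∀ x : L,
        actLevel b m x (mon R T) ∈ degLE R I (T.card + 1) := by
      intro T hT x
      induction x using basis_induction b with
      | h a =>
        rw [← sub_add_cancel (actLevel b m (b a) (mon R T)) (mon R (a ::ₘ T))]
        exact add_mem (degLE_mono (Nat.le_succ _) (ih a T hT)) (mon_mem_degLE (by simp))
      | h0 => simp
      | hadd x y hx hy => rw [map_add]; exact add_mem hx hy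
      | hsmul c x hx => rw [map_smul]; exact Submodule.smul_mem _ c hx
    rcases sort_cons_cases M with rfl | ⟨c, T, rfl, -, hs⟩
    · simp [actStepMon]
    · rw [hs, actStepMon_cons, add_sub_cancel_left]
      rw [Multiset.card_cons] at hM ⊢
      split_ifs
      · exact zero_mem _
      · refine add_mem ?_ (key T (by omega) _)
        exact map_mem_of_mem_supported _ (fun K hK => degLE_mono (Nat.succ_le_succ hK)
          (key K (lt_of_le_of_lt hK (by omega)) _)) (ih a T (by omega))

/-- The levels stabilize, so the action on a monomial may be read off at any level above its degree.
-/
theorem actLevel_succ_eq (m : ℕ) (x : L) (M : Multiset I) (hM : M.card < m) :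
    actLevel b (m + 1) x (mon R M) = actLevel b m x (mon R M) := by
  induction m generalizing x M with
  | zero => omega
  | succ m ih =>
    induction x using basis_induction b with
    | h a =>
      rw [actLevel_succ, actLevel_succ]
      rcases sort_cons_cases M with rfl | ⟨c, T, rfl, -, hs⟩
      · simp [actStepMon]
      · rw [Multiset.card_cons] at hM
        have hT : T.card < m := by omega
        rw [hs, actStepMon_cons, actStepMon_cons, ih _ T hT, ih _ T hT]
        congr 3
        exact eq_of_mem_supported _ _ (fun K hK => ih _ K (lt_of_le_of_lt hK hT))
          (actLevel_sub_mem b m a T hT)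
    | h0 => simp
    | hadd x y hx hy => simp only [map_add, LinearMap.add_apply, hx, hy]
    | hsmul c x hx => simp only [map_smul, LinearMap.smul_apply, hx]

theorem actLevel_eq_of_le {m n : ℕ} (h : m ≤ n) (x : L) (M : Multiset I) (hM : M.card < m) :
    actLevel b n x (mon R M) = actLevel b m x (mon R M) := by
  induction n, h using Nat.le_induction with
  | base => rfl
  | succ n h ih => rw [actLevel_succ_eq b n x M (by omega), ih]

/-- The action of `L` on the span of the monomials. -/
noncomputable def act : L →ₗ[R] Module.End R (Multiset I →₀ R) :=
  b.constr R fun a => Finsupp.linearCombination R fun M => actLevel b (M.card + 1) (b a) (mon R M)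

theorem act_eq_actLevel {m : ℕ} (x : L) (M : Multiset I) (hM : M.card < m) :
    act b x (mon R M) = actLevel b m x (mon R M) := by
  induction x using basis_induction b with
  | h a =>
    rw [act, Module.Basis.constr_basis, linearCombination_mon]
    exact (actLevel_eq_of_le b hM _ M (Nat.lt_succ_self _)).symm
  | h0 => simp
  | hadd x y hx hy => simp only [map_add, LinearMap.add_apply, hx, hy]
  | hsmul c x hx => simp only [map_smul, LinearMap.smul_apply, hx]

theorem act_sub_mem (a : I) (M : Multiset I) :
    act b (b a) (mon R M) - mon R (a ::ₘ M) ∈ degLE R I M.card := by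
  rw [act_eq_actLevel b _ M (Nat.lt_succ_self _)]
  exact actLevel_sub_mem b _ a M (Nat.lt_succ_self _)

theorem act_of_le (a : I) (M : Multiset I) (h : ∀ d ∈ M, a ≤ d) :
    act b (b a) (mon R M) = mon R (a ::ₘ M) := by
  rw [act_eq_actLevel b _ M (Nat.lt_succ_self _), actLevel_succ]
  rcases sort_cons_cases M with rfl | ⟨c, T, rfl, -, hs⟩
  · simp [actStepMon]
  · rw [hs, actStepMon_cons, if_pos (h c (Multiset.mem_cons_self c T)), add_zero]

theorem act_cons (a c : I) (T : Multiset I) (hca : c < a) (hT : ∀ d ∈ T, c ≤ d) :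
    act b (b a) (mon R (c ::ₘ T)) = mon R (a ::ₘ c ::ₘ T) +
      (act b (b c) (act b (b a) (mon R T) - mon R (a ::ₘ T)) + act b ⁅b a, b c⁆ (mon R T)) := by
  have hlt : T.card < (c ::ₘ T).card := by simp
  rw [act_eq_actLevel b _ _ (Nat.lt_succ_self _), actLevel_succ, Multiset.sort_cons (r := (· ≤ ·)) _ _ hT,
    actStepMon_cons, if_neg (not_le.2 hca), ← act_eq_actLevel b _ T hlt,
    ← act_eq_actLevel b _ T hlt]
  congr 2
  exact (eq_of_mem_supported _ _ (fun K hK => act_eq_actLevel b _ K (lt_of_le_of_lt hK hlt))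
    (act_sub_mem b a T)).symm

/-- The recursive rule was designed to be this case of the commutation relation: the new monomial
`z_{acT}` in it cancels against `c · z_{aT}`. -/
theorem act_act_of_lt (a c : I) (T : Multiset I) (hca : c < a) (hT : ∀ d ∈ T, c ≤ d) :
    act b (b a) (act b (b c) (mon R T)) =
      act b (b c) (act b (b a) (mon R T)) + act b ⁅b a, b c⁆ (mon R T) := by
  have : act b (b c) (mon R (a ::ₘ T)) = mon R (c ::ₘ a ::ₘ T) :=
    act_of_le b c _ fun d hd => by
      rcases Multiset.mem_cons.1 hd with rfl | hd
      exacts [hca.le, hT d hd]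
  rw [act_of_le b c T hT, act_cons b a c T hca hT, map_sub, this, Multiset.cons_swap]
  abel

/-- Bilinearity and antisymmetry reduce to basis elements with `c < a`. If `c` is at most all of
`T`, the relation holds by the recursive rule. Otherwise the least index `d` of `T` is below `c`,
and `z_T = d · z_P`; moving `d` to the far left past `a` and `c` leaves the relation on `z_P`, known
by induction, and terms that cancel by the Jacobi identity. -/
theorem act_lie_mon (x y : L) (T : Multiset I) :
    act b x (act b y (mon R T)) = act b y (act b x (mon R T)) + act b ⁅x, y⁆ (mon R T) := by
  induction hk : T.card using Nat.strong_induction_on generalizing x y T with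
  | _ k ih =>
  subst hk
  induction x using basis_induction b with
  | h0 => simp
  | hadd x x' hx hx' => simp only [map_add, LinearMap.add_apply, add_lie, hx, hx']; abel
  | hsmul c x hx => simp only [map_smul, LinearMap.smul_apply, smul_lie, hx, smul_add]
  | h a =>
  induction y using basis_induction b with
  | h0 => simp
  | hadd x x' hx hx' => simp only [map_add, LinearMap.add_apply, lie_add, hx, hx']; abel
  | hsmul c x hx => simp only [map_smul, LinearMap.smul_apply, lie_smul, hx, smul_add]
  | h c =>
  suffices H : ∀ a c : I, c < a → act b (b a) (act b (b c) (mon R T)) =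
      act b (b c) (act b (b a) (mon R T)) + act b ⁅b a, b c⁆ (mon R T) by
    rcases lt_trichotomy a c with h | rfl | h
    · rw [H c a h, ← lie_skew, map_neg, LinearMap.neg_apply]
      abel
    · simp
    · exact H a c h
  intro a c hca
  by_cases hT : ∀ d ∈ T, c ≤ d
  · exact act_act_of_lt b a c T hca hT
  rcases sort_cons_cases T with rfl | ⟨d, P, rfl, hP, -⟩
  · simp at hT
  have hdc : d < c := by
    by_contra! h
    refine hT fun e he => ?_
    rcases Multiset.mem_cons.1 he with rfl | he
    exacts [h, h.trans (hP e he)]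
  have hcard : P.card < (d ::ₘ P).card := by simp
  have ihP := fun x y => ih P.card hcard x y P rfl
  -- the action of `d` commutes with that of `a` on `act (b c) z_P`
  have key : ∀ a c : I, d < a → d < c → act b (b a) (act b (b d) (act b (b c) (mon R P))) =
      act b (b d) (act b (b a) (act b (b c) (mon R P))) +
        act b ⁅b a, b d⁆ (act b (b c) (mon R P)) := by
    intro a c hda hdc
    have h1 := act_act_of_lt b a d (c ::ₘ P) hda fun e he => by
      rcases Multiset.mem_cons.1 he with rfl | he
      exacts [hdc.le, hP e he]
    have h2 := eq_of_mem_supported (act b (b a) ∘ₗ act b (b d))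
      (act b (b d) ∘ₗ act b (b a) + act b ⁅b a, b d⁆)
      (fun K hK => ih K.card (lt_of_le_of_lt hK hcard) _ _ K rfl) (act_sub_mem b c P)
    simp only [LinearMap.comp_apply, LinearMap.add_apply] at h2
    -- The leading monomial `z_{cP}` is as long as `T`, so it needs the recursive rule `h1`; the
    -- rest `w` has degree at most `|P|` and falls under the induction, `h2`.
    obtain ⟨w, hw⟩ : ∃ w, act b (b c) (mon R P) = w + mon R (c ::ₘ P) :=
      ⟨_, (sub_add_cancel _ _).symm⟩
    rw [hw, add_sub_cancel_right] at h2
    simp only [hw, map_add]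
    rw [h1, h2]
    abel
  rw [← act_of_le b d P hP, ihP (b c) (b d), ihP (b a) (b d), ihP ⁅b a, b c⁆ (b d)]
  simp only [map_add]
  rw [key a c (hdc.trans hca) hdc, key c a hdc (hdc.trans hca), ihP (b a) ⁅b c, b d⁆,
    ihP (b c) ⁅b a, b d⁆, ihP (b a) (b c), lie_lie]
  simp only [map_add, map_sub, LinearMap.sub_apply]
  abel

/-- The Poincaré–Birkhoff–Witt module, as a representation of `L`. -/
noncomputable def actHom : L →ₗ⁅R⁆ Module.End R (Multiset I →₀ R) :=
  { act b with
    map_lie' := fun {x y} => by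
      apply linearMap_ext_mon
      intro T
      change act b ⁅x, y⁆ (mon R T) =
        act b x (act b y (mon R T)) - act b y (act b x (mon R T))
      rw [act_lie_mon b x y T, add_sub_cancel_left] }

/-- The Poincaré–Birkhoff–Witt module, as a representation of `U(L)`. -/
noncomputable def envAct : UniversalEnvelopingAlgebra R L →ₐ[R] Module.End R (Multiset I →₀ R) :=
  UniversalEnvelopingAlgebra.lift R (actHom b)

theorem envAct_ι (x : L) : envAct b (UniversalEnvelopingAlgebra.ι R x) = act b x :=
  UniversalEnvelopingAlgebra.lift_ι_apply R (actHom b) x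

end PBW

/-- Acting on the empty monomial recovers coordinates: `x · z_∅` is the sum of the `xₐ z_{a}`. -/
theorem ι_injective {R : Type*} [CommRing R] {L : Type*} [LieRing L] [LieAlgebra R L]
    [Module.Free R L] : Function.Injective (UniversalEnvelopingAlgebra.ι R : L →ₗ⁅R⁆ _) := by
  let b := Module.Free.chooseBasis R L
  classical
  let _ : LinearOrder (Module.Free.ChooseBasisIndex R L) := linearOrderOfSTO WellOrderingRel
  have h : ∀ x : L, Finsupp.lmapDomain R R (fun a : Module.Free.ChooseBasisIndex R L =>
      ({a} : Multiset _)) (b.repr x) = envAct b (UniversalEnvelopingAlgebra.ι R x) (mon R 0) := by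
    intro x
    rw [envAct_ι]
    induction x using basis_induction b with
    | h a => rw [act_of_le b a 0 (by simp)]; simp [mon]
    | h0 => simp
    | hadd x y hx hy => simp only [map_add, LinearMap.add_apply, hx, hy]
    | hsmul c x hx => simp only [map_smul, LinearMap.smul_apply, hx]
  intro x y hxy
  apply b.repr.injective
  refine Finsupp.mapDomain_injective (f := fun a => ({a} : Multiset _))
    (fun _ _ h => Multiset.singleton_inj.1 h) ?_
  exact (h x).trans ((by rw [hxy]) : _ = _) |>.trans (h y).symm

/-! ### Weights on the Poincaré–Birkhoff–Witt module -/

section Weight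

open Finsupp

variable {R : Type*} [CommRing R] {I : Type*} (w : I → ℕ)

/-- The weight of a monomial. -/
def wt (M : Multiset I) : ℕ := (M.map w).sum

theorem wt_cons (a : I) (M : Multiset I) : wt w (a ::ₘ M) = w a + wt w M := by
  simp [wt]

/-- The span of the monomials of weight at least `k`. -/
noncomputable def wtGE (R : Type*) [CommRing R] (k : ℕ) : Submodule R (Multiset I →₀ R) :=
  supported R R {M | k ≤ wt w M}

theorem mon_mem_wtGE {k : ℕ} {M : Multiset I} (h : k ≤ wt w M) : mon R M ∈ wtGE w R k :=
  mon_mem_supported h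

variable {L : Type*} [LieRing L] [LieAlgebra R L] (b : Module.Basis I R L)

/-- The span of the basis elements of weight at least `k`. -/
def basisGE (k : ℕ) : Submodule R L := Submodule.span R (b '' {a | k ≤ w a})

variable {A : Type*} [Ring A] [Algebra R A] (v : I → A)

/-- The linear map sending the basis elements of weight `m` to their values under `v`, and the
others to `0`. -/
noncomputable def basisLead (w : I → ℕ) (b : Module.Basis I R L) (m : ℕ) : L →ₗ[R] A :=
  b.constr R fun a => if w a = m then v a else 0

theorem basisLead_basis (m : ℕ) (a : I) :
    basisLead v w b m (b a) = if w a = m then v a else 0 := by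
  rw [basisLead, Module.Basis.constr_basis]

variable [LinearOrder I] {w b} {N : ℕ}

/-- By induction on the degree, every term of the recursive rule for `z_{cT}` has weight at least `w
a + w c + wt T`, capped at `N`. The cap is needed because the basis is adapted to the filtration
only up to step `N`. -/
theorem act_mon_mem_wtGE
    (hb : ∀ a c m, m ≤ N → m ≤ w a + w c → ⁅b a, b c⁆ ∈ basisGE w b m)
    (a : I) (M : Multiset I) {m : ℕ} (hm : m ≤ N) (hmM : m ≤ w a + wt w M) :
    act b (b a) (mon R M) ∈ wtGE w R m := by
  induction hk : M.card using Nat.strong_induction_on generalizing a M m with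
  | _ k ih =>
  subst hk
  by_cases hle : ∀ d ∈ M, a ≤ d
  · rw [act_of_le b a M hle]
    exact mon_mem_wtGE w (by rwa [wt_cons])
  rcases sort_cons_cases M with rfl | ⟨c, T, rfl, hT, -⟩
  · simp at hle
  have hca : c < a := by
    by_contra! h
    refine hle fun e he => ?_
    rcases Multiset.mem_cons.1 he with rfl | he
    exacts [h, h.trans (hT e he)]
  have hcard : T.card < (c ::ₘ T).card := by simp
  rw [wt_cons] at hmM
  rw [act_cons b a c T hca hT]
  refine add_mem (mon_mem_wtGE w (by rwa [wt_cons, wt_cons])) (add_mem ?_ ?_)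
  -- The correction is placed in both filtrations at once: its degree feeds the induction, its
  -- weight the estimate.
  · have h1 : act b (b a) (mon R T) - mon R (a ::ₘ T) ∈
        supported R R ({K | K.card ≤ T.card} ∩ {K | min (w a + wt w T) N ≤ wt w K}) := by
      rw [supported_inter]
      refine ⟨act_sub_mem b a T, sub_mem (ih _ hcard a T (min_le_right _ _) (min_le_left _ _) rfl)
        (mon_mem_wtGE w ?_)⟩
      rw [wt_cons]
      exact min_le_left _ _
    refine map_mem_of_mem_supported _ (fun K hK => ?_) h1
    obtain ⟨hK1, hK2⟩ := hK
    exact ih K.card (lt_of_le_of_lt hK1 hcard) c K hm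
      (by simp only [Set.mem_ofPred_eq] at hK2; omega) rfl
  · have h2 := hb a c (min (w a + w c) N) (min_le_right _ _) (min_le_left _ _)
    generalize ⁅b a, b c⁆ = x at h2
    induction h2 using Submodule.span_induction with
    | mem x hx =>
      obtain ⟨e, he : min (w a + w c) N ≤ w e, rfl⟩ := hx
      exact ih _ hcard e T hm (by omega) rfl
    | zero => simp
    | add x y _ _ hx hy => rw [map_add]; exact add_mem hx hy
    | smul c x _ hx => rw [map_smul]; exact Submodule.smul_mem _ c hx

theorem act_mem_wtGE
    (hb : ∀ a c m, m ≤ N → m ≤ w a + w c → ⁅b a, b c⁆ ∈ basisGE w b m)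
    {i k m : ℕ} (hm : m ≤ N) (hik : m ≤ i + k) {x : L} (hx : x ∈ basisGE w b i)
    {s : Multiset I →₀ R} (hs : s ∈ wtGE w R k) : act b x s ∈ wtGE w R m := by
  induction hx using Submodule.span_induction with
  | mem x hx =>
    obtain ⟨e, he : i ≤ w e, rfl⟩ := hx
    exact map_mem_of_mem_supported _ (fun K hK => act_mon_mem_wtGE hb e K hm
      (by simp only [Set.mem_ofPred_eq] at hK; omega)) hs
  | zero => simp
  | add x y _ _ hx hy => rw [map_add]; exact add_mem hx hy
  | smul c x _ hx => rw [map_smul]; exact Submodule.smul_mem _ c hx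

/-- The linear map sending the monomials of weight `m` to the corresponding sorted products, and
the others to `0`. -/
noncomputable def lead (R : Type*) [CommRing R] [Algebra R A] (w : I → ℕ) (m : ℕ) :
    (Multiset I →₀ R) →ₗ[R] A :=
  Finsupp.linearCombination R fun M =>
    if wt w M = m then ((M.sort (· ≤ ·)).map v).prod else 0

theorem lead_mon (m : ℕ) (M : Multiset I) :
    lead v R w m (mon R M) = if wt w M = m then ((M.sort (· ≤ ·)).map v).prod else 0 :=
  linearCombination_mon _ M

theorem lead_mon_cons (k m : ℕ) (a : I) (M : Multiset I) (h : ∀ d ∈ M, a ≤ d)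
    (hm : w a + k = m) : lead v R w m (mon R (a ::ₘ M)) = v a * lead v R w k (mon R M) := by
  rw [lead_mon, lead_mon, Multiset.sort_cons (r := (· ≤ ·)) _ _ h, List.map_cons, List.prod_cons,
    wt_cons]
  by_cases hk : wt w M = k
  · rw [if_pos (by omega), if_pos hk]
  · rw [if_neg (by omega), if_neg hk, mul_zero]

theorem lead_eq_zero {k m : ℕ} (h : m < k) {s : Multiset I →₀ R} (hs : s ∈ wtGE w R k) :
    lead v R w m s = 0 := by
  refine eq_of_mem_supported (lead v R w m) 0 (fun M hM => ?_) hs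
  rw [lead_mon, if_neg, LinearMap.zero_apply]
  change k ≤ wt w M at hM
  omega

variable {v}

/-- By induction on the degree, since `v` obeys the same commutation rule as the action, up to
heavier terms. The hypothesis is `k ≤ wt w M`, not equality, because the corrections contain heavier
monomials; on those both sides vanish. -/
theorem lead_act_mon
    (hb : ∀ a c m, m ≤ N → m ≤ w a + w c → ⁅b a, b c⁆ ∈ basisGE w b m)
    (hv : ∀ a c, w a + w c < N →
      v a * v c - v c * v a = basisLead v w b (w a + w c) ⁅b a, b c⁆)
    (a : I) (M : Multiset I) {k m : ℕ} (hm : w a + k = m) (hmN : m < N) (hkM : k ≤ wt w M) :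
    lead v R w m (act b (b a) (mon R M)) = v a * lead v R w k (mon R M) := by
  induction hd : M.card using Nat.strong_induction_on generalizing a M m k with
  | _ d ih =>
  subst hd
  rcases hkM.lt_or_eq with hlt | rfl
  · rw [lead_eq_zero v (Nat.lt_succ_self m) (act_mon_mem_wtGE hb a M hmN (by omega)),
      lead_eq_zero v hlt (mon_mem_wtGE w le_rfl), mul_zero]
  by_cases hle : ∀ d ∈ M, a ≤ d
  · rw [act_of_le b a M hle, lead_mon_cons v _ m a M hle hm]
  rcases sort_cons_cases M with rfl | ⟨c, T, rfl, hT, -⟩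
  · simp at hle
  have hca : c < a := by
    by_contra! h
    refine hle fun e he => ?_
    rcases Multiset.mem_cons.1 he with rfl | he
    exacts [h, h.trans (hT e he)]
  have hcard : T.card < (c ::ₘ T).card := by simp
  rw [wt_cons] at hm
  have hcaT : ∀ d ∈ a ::ₘ T, c ≤ d := fun d hd => by
    rcases Multiset.mem_cons.1 hd with rfl | hd
    exacts [hca.le, hT d hd]
  have h1 : act b (b a) (mon R T) - mon R (a ::ₘ T) ∈
      supported R R ({K | K.card ≤ T.card} ∩ {K | w a + wt w T ≤ wt w K}) := by
    rw [supported_inter]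
    exact ⟨act_sub_mem b a T, sub_mem (act_mon_mem_wtGE hb a T (by omega) le_rfl)
      (mon_mem_wtGE w (by rw [wt_cons]))⟩
  have h2 := eq_of_mem_supported (lead v R w m ∘ₗ act b (b c))
    (LinearMap.mulLeft R (v c) ∘ₗ lead v R w (w a + wt w T))
    (fun K hK => ih K.card (lt_of_le_of_lt hK.1 hcard) c K (by omega) hmN hK.2 rfl) h1
  simp only [LinearMap.comp_apply, LinearMap.mulLeft_apply] at h2
  have h3 : lead v R w m (act b ⁅b a, b c⁆ (mon R T)) =
      basisLead v w b (w a + w c) ⁅b a, b c⁆ * lead v R w (wt w T) (mon R T) := by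
    have h := hb a c _ (by omega) le_rfl
    generalize ⁅b a, b c⁆ = x at h
    induction h using Submodule.span_induction with
    | mem x hx =>
      obtain ⟨e, he : w a + w c ≤ w e, rfl⟩ := hx
      rw [basisLead_basis]
      rcases he.lt_or_eq with hlt | heq
      · rw [if_neg hlt.ne', zero_mul]
        exact lead_eq_zero v (Nat.lt_succ_self m) (act_mon_mem_wtGE hb e T hmN (by omega))
      · rw [if_pos heq.symm]
        exact ih _ hcard e T (by omega) hmN le_rfl rfl
    | zero => simp
    | add x y _ _ hx hy => simp only [map_add, LinearMap.add_apply, hx, hy, add_mul]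
    | smul c x _ hx => simp only [map_smul, LinearMap.smul_apply, hx, smul_mul_assoc]
  -- With `ℓ` the leading part, the three terms become `v_c ℓ(z_{aT})`, `v_c (v_a ℓ(z_T) -
  -- ℓ(z_{aT}))` and `(v_a v_c - v_c v_a) ℓ(z_T)`, which add up to `v_a v_c ℓ(z_T)`.
  rw [act_cons b a c T hca hT, map_add, map_add, h2, h3, Multiset.cons_swap,
    lead_mon_cons v (w a + wt w T) m c _ hcaT (by omega), map_sub,
    ih _ hcard a T rfl (by omega) le_rfl rfl, wt_cons, lead_mon_cons v (wt w T) _ c T hT rfl,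
    ← hv a c (by omega)]
  noncomm_ring

theorem lead_act
    (hb : ∀ a c m, m ≤ N → m ≤ w a + w c → ⁅b a, b c⁆ ∈ basisGE w b m)
    (hv : ∀ a c, w a + w c < N →
      v a * v c - v c * v a = basisLead v w b (w a + w c) ⁅b a, b c⁆)
    {i k m : ℕ} (hm : i + k = m) (hmN : m < N) {x : L} (hx : x ∈ basisGE w b i)
    {s : Multiset I →₀ R} (hs : s ∈ wtGE w R k) :
    lead v R w m (act b x s) = basisLead v w b i x * lead v R w k s := by
  induction hx using Submodule.span_induction with
  | mem x hx =>
    obtain ⟨e, he : i ≤ w e, rfl⟩ := hx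
    rw [basisLead_basis]
    rcases he.lt_or_eq with hlt | rfl
    · rw [if_neg hlt.ne', zero_mul]
      exact lead_eq_zero v (Nat.lt_succ_self m) (act_mem_wtGE hb hmN (by omega : m + 1 ≤ w e + k)
        (Submodule.subset_span ⟨e, by simp, rfl⟩) hs)
    · rw [if_pos rfl]
      exact eq_of_mem_supported (lead v R w m ∘ₗ act b (b e))
        (LinearMap.mulLeft R (v e) ∘ₗ lead v R w k)
        (fun K hK => lead_act_mon hb hv e K hm hmN hK) hs
  | zero => simp
  | add x y _ _ hx hy => simp only [map_add, LinearMap.add_apply, hx, hy, add_mul]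
  | smul c x _ hx => simp only [map_smul, LinearMap.smul_apply, hx, smul_mul_assoc]

end Weight

/-! ### Bases adapted to a filtration -/

/-- Start with a basis of the smallest term `P N` and extend it step by step to larger ones; `d`
counts the steps taken. The truncation at `N` provides the starting point. -/
theorem exists_adapted_linearIndepOn {F V : Type*} [Field F] [AddCommGroup V] [Module F V]
    (P : ℕ → Submodule F V) (hP : Antitone P) (N d : ℕ) :
    ∃ B : Set V, LinearIndepOn F id B ∧ B ⊆ P (N - d) ∧
      ∀ i, N - d ≤ i → i ≤ N → P i ≤ Submodule.span F (B ∩ P i) := by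
  induction d with
  | zero =>
    obtain ⟨B, hBP, -, hB, hli⟩ := exists_linearIndepOn_id_extension
      (linearIndependent_empty F V) (Set.empty_subset (P N : Set V))
    refine ⟨B, hli, hBP, fun i hi hiN => ?_⟩
    obtain rfl : i = N := by omega
    rwa [Set.inter_eq_left.2 hBP]
  | succ d ih =>
    obtain ⟨B, hli, hBP, hB⟩ := ih
    obtain ⟨B', hBP', hBB', hB', hli'⟩ := exists_linearIndepOn_id_extension hli
      (hBP.trans (hP (by omega : N - (d + 1) ≤ N - d)))
    refine ⟨B', hli', hBP', fun i hi hiN => ?_⟩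
    rcases hi.lt_or_eq with h | rfl
    · exact (hB i (by omega) hiN).trans
        (Submodule.span_mono (Set.inter_subset_inter_left _ hBB'))
    · rwa [Set.inter_eq_left.2 hBP']

/-- A finite filtration of a vector space has an adapted basis; the weight of a basis vector is
the last step of the filtration that contains it. -/
theorem exists_adapted_basis {F V : Type*} [Field F] [AddCommGroup V] [Module F V]
    (P : ℕ → Submodule F V) (hP : Antitone P) (h1 : P 1 = ⊤) (N : ℕ) (hN : 1 ≤ N) :
    ∃ (B : Set V) (b : Module.Basis B F V) (w : B → ℕ), (∀ a, 1 ≤ w a) ∧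
      (∀ a, b a ∈ P (w a)) ∧ ∀ i ≤ N, P i ≤ Submodule.span F (b '' {a | i ≤ w a}) := by
  classical
  obtain ⟨B, hli, -, hB⟩ := exists_adapted_linearIndepOn P hP N (N - 1)
  have hspan : ⊤ ≤ Submodule.span F (Set.range (Subtype.val : B → V)) := by
    rw [Subtype.range_coe, ← h1]
    exact (hB 1 (by omega) hN).trans (Submodule.span_mono Set.inter_subset_left)
  let b : Module.Basis B F V := Module.Basis.mk hli hspan
  have hb : ∀ a : B, b a = a := fun a => Module.Basis.mk_apply hli hspan a
  -- The search stops at `N`, so every basis vector in `P N` has weight exactly `N`, however deep in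
  -- the filtration it lies.
  let w : B → ℕ := fun a => Nat.findGreatest (fun i => (a : V) ∈ P i) N
  have hmem1 : ∀ v : V, v ∈ P 1 := fun v => by rw [h1]; trivial
  refine ⟨B, b, w, fun a => Nat.le_findGreatest hN (hmem1 _), fun a => ?_, fun i hi => ?_⟩
  · rw [hb]
    exact Nat.findGreatest_spec (P := fun i => (a : V) ∈ P i) hN (hmem1 _)
  · have h2 : ∀ i, 1 ≤ i → i ≤ N → P i ≤ Submodule.span F (b '' {a | i ≤ w a}) := fun i hi1 hi =>
      (hB i (by omega) hi).trans <| Submodule.span_mono fun v hv =>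
        ⟨⟨v, hv.1⟩, Nat.le_findGreatest hi hv.2, hb _⟩
    rcases Nat.eq_zero_or_pos i with rfl | hi1
    · refine le_top.trans (h1 ▸ (h2 1 le_rfl hN).trans (Submodule.span_mono ?_))
      exact Set.image_mono fun a _ => Nat.zero_le _
    · exact h2 i hi1 hi

/-! ### Augmentation ideal -/

/-- The elements satisfying `p` form a subalgebra `S` containing the image of `L`. The map `U(L) →
S` induced by `L → S`, followed by the inclusion, is the identity on `L`, hence everywhere. -/
theorem env_induction {R L : Type*} [CommRing R] [LieRing L] [LieAlgebra R L]
    {p : UniversalEnvelopingAlgebra R L → Prop}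
    (algebraMap : ∀ c, p (algebraMap R _ c)) (ι : ∀ x, p (UniversalEnvelopingAlgebra.ι R x))
    (mul : ∀ u v, p u → p v → p (u * v)) (add : ∀ u v, p u → p v → p (u + v))
    (u : UniversalEnvelopingAlgebra R L) : p u := by
  let S : Subalgebra R (UniversalEnvelopingAlgebra R L) :=
    { carrier := {u | p u}
      mul_mem' := fun {u v} hu hv => mul u v hu hv
      add_mem' := fun {u v} hu hv => add u v hu hv
      algebraMap_mem' := algebraMap }
  let f : L →ₗ⁅R⁆ S :=
    { (UniversalEnvelopingAlgebra.ι R : L →ₗ⁅R⁆ _).toLinearMap.codRestrict S.toSubmodule ι with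
      map_lie' := fun {x y} => Subtype.ext <| by
        change UniversalEnvelopingAlgebra.ι R ⁅x, y⁆ = _
        rw [LieHom.map_lie, LieRing.of_associative_ring_bracket]
        rfl }
  have h : S.val.comp (UniversalEnvelopingAlgebra.lift R f) = AlgHom.id R _ := by
    ext x
    change ((UniversalEnvelopingAlgebra.lift R f (UniversalEnvelopingAlgebra.ι R x) : S) :
      UniversalEnvelopingAlgebra R L) = UniversalEnvelopingAlgebra.ι R x
    rw [UniversalEnvelopingAlgebra.lift_ι_apply]
    rfl
  rw [← AlgHom.id_apply (R := R) u, ← h]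
  exact (UniversalEnvelopingAlgebra.lift R f u).2

section AugmentationIdeal

variable (F : Type*) [Field F] (L : Type*) [LieRing L] [LieAlgebra F L]

theorem augmentation_ι (x : L) : augmentation F L (UniversalEnvelopingAlgebra.ι F x) = 0 :=
  UniversalEnvelopingAlgebra.lift_ι_apply F (0 : L →ₗ⁅F⁆ F) x

theorem mem_omegaPow_one {u : UniversalEnvelopingAlgebra F L} :
    u ∈ omegaPow F L 1 ↔ augmentation F L u = 0 := by
  rw [omegaPow, Submodule.pow_one, Submodule.restrictScalars_mem, omega, RingHom.mem_ker]

theorem mem_omegaPow_zero (u : UniversalEnvelopingAlgebra F L) : u ∈ omegaPow F L 0 := by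
  simpa using mul_mem_omegaPow F L (i := 0) (j := 0) (x := u)
    (by rw [omegaPow, Submodule.restrictScalars_mem, Submodule.pow_zero, Ideal.one_eq_top]; trivial)
    (one_mem_omegaPow_zero F L)

@[elab_as_elim]
theorem omegaPow_succ_induction {n : ℕ} {p : UniversalEnvelopingAlgebra F L → Prop}
    (mul : ∀ u ∈ omegaPow F L 1, ∀ v ∈ omegaPow F L n, p (u * v))
    (add : ∀ u v, p u → p v → p (u + v)) {u : UniversalEnvelopingAlgebra F L}
    (hu : u ∈ omegaPow F L (n + 1)) : p u := by
  rw [omegaPow, Submodule.restrictScalars_mem, add_comm, Ideal.IsTwoSided.pow_add] at hu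
  exact Submodule.smul_induction_on (I := omega F L ^ 1) (N := omega F L ^ n) hu mul add

theorem omegaPow_succ_le (n : ℕ) : omegaPow F L (n + 1) ≤ omegaPow F L n := fun u hu => by
  induction n generalizing u with
  | zero => exact mem_omegaPow_zero F L u
  | succ n ih =>
    refine omegaPow_succ_induction F L (fun u hu v hv => ?_) (fun _ _ => add_mem) hu
    rw [add_comm]
    exact mul_mem_omegaPow F L hu (ih v hv)

theorem sub_augmentation_mem (u : UniversalEnvelopingAlgebra F L) :
    u - algebraMap F _ (augmentation F L u) ∈ omegaPow F L 1 := by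
  rw [mem_omegaPow_one, map_sub, AlgHom.commutes]
  simp

theorem exists_ι_sub_mem (u : UniversalEnvelopingAlgebra F L) :
    ∃ x : L, u - algebraMap F _ (augmentation F L u) - UniversalEnvelopingAlgebra.ι F x ∈
      omegaPow F L 2 := by
  induction u using env_induction with
  | algebraMap c => exact ⟨0, by simp⟩
  | ι x => exact ⟨x, by
    rw [augmentation_ι, map_zero, sub_zero, sub_self]; exact zero_mem _⟩
  | add u v hu hv =>
    obtain ⟨x, hx⟩ := hu
    obtain ⟨y, hy⟩ := hv
    refine ⟨x + y, ?_⟩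
    convert add_mem hx hy using 1
    simp only [map_add]
    abel
  | mul u v hu hv =>
    obtain ⟨x, hx⟩ := hu
    obtain ⟨y, hy⟩ := hv
    -- Modulo `ω²`, `(ε(u) + x)(ε(v) + y) = ε(u)ε(v) + ε(v)x + ε(u)y`, as `xy ∈ ω²`.
    refine ⟨augmentation F L v • x + augmentation F L u • y, ?_⟩
    have h := mul_mem_omegaPow F L (sub_augmentation_mem F L u) (sub_augmentation_mem F L v)
    convert add_mem h (add_mem (Submodule.smul_mem _ (augmentation F L v) hx)
      (Submodule.smul_mem _ (augmentation F L u) hy)) using 1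
    simp only [map_add, map_mul, map_smul, Algebra.algebraMap_eq_smul_one, smul_sub, sub_mul,
      mul_sub, smul_mul_assoc, mul_smul_comm, one_mul, mul_one, smul_smul,
      mul_comm (augmentation F L v)]
    abel

theorem exists_ι_sub_mem_of_mem {u : UniversalEnvelopingAlgebra F L} (hu : u ∈ omegaPow F L 1) :
    ∃ x : L, u - UniversalEnvelopingAlgebra.ι F x ∈ omegaPow F L 2 := by
  obtain ⟨x, hx⟩ := exists_ι_sub_mem F L u
  rw [(mem_omegaPow_one F L).1 hu, map_zero, sub_zero] at hx
  exact ⟨x, hx⟩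

end AugmentationIdeal

/-! ### Injectivity and surjectivity of `φ` -/

variable (F : Type u) [Field F] (L : Type v) [LieRing L] [LieAlgebra F L]

theorem SubQuot.mk_eq_zero_iff {M : Type*} [AddCommGroup M] [Module F M] {P P' : Submodule F M}
    {x : M} (hx : x ∈ P) : (SubQuot.mk x hx : SubQuot P P') = 0 ↔ x ∈ P' :=
  Submodule.Quotient.mk_eq_zero _

theorem GrLieComp.mk_eq_zero_iff {i : ℕ+} {x : L} (hx : x ∈ gamma F L i) :
    GrLieComp.mk F L i x hx = 0 ↔ x ∈ gamma F L (i + 1) :=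
  SubQuot.mk_eq_zero_iff F (P := (gamma F L i).toSubmodule)
    (P' := (gamma F L (i + 1)).toSubmodule) hx

theorem GrEnvComp.mk_eq_zero_iff {n : ℕ} {x : UniversalEnvelopingAlgebra F L}
    (hx : x ∈ omegaPow F L n) : GrEnvComp.mk F L n x hx = 0 ↔ x ∈ omegaPow F L (n + 1) :=
  SubQuot.mk_eq_zero_iff F hx

theorem GrLie.of_smul (i : ℕ+) (c : F) (x : L) (hx : x ∈ gamma F L i) :
    GrLie.of F L i (c • x) ((gamma F L i).smul_mem c hx) = c • GrLie.of F L i x hx :=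
  map_smul (GrLie.incl F L i) c (GrLieComp.mk F L i x hx)

theorem GrLie.of_eq_zero {i : ℕ+} {x : L} (hx : x ∈ gamma F L i)
    (h : x ∈ gamma F L (i + 1)) : GrLie.of F L i x hx = 0 := by
  rw [GrLie.of, (GrLieComp.mk_eq_zero_iff F L hx).2 h, map_zero]

/-- An element of `γᵢ` has no coordinates of weight below `i`, and basis vectors of weight above `i`
vanish in `γᵢ/γᵢ₊₁`. What remains is the part of weight `i`, so the leading part of `x` depends only
on its class. -/
theorem basisLead_of_mem_gamma {F : Type*} [Field F] {L : Type*} [LieRing L] [LieAlgebra F L]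
    {B : Type*} {b : Module.Basis B F L} {N : ℕ}
    {w : B → ℕ+} (hbw : ∀ a, b a ∈ gamma F L (w a))
    (hspan : ∀ i ≤ N, ∀ x ∈ gamma F L i, x ∈ basisGE (fun a => (w a : ℕ)) b i)
    {A : Type*} [Ring A] [Algebra F A] (f : GrLie F L →ₗ[F] A)
    {i : ℕ+} (hi : (i : ℕ) ≤ N) {x : L} (hx : x ∈ gamma F L i) :
    basisLead (fun a => f (GrLie.of F L (w a) (b a) (hbw a))) (fun a => (w a : ℕ)) b i x =
      f (GrLie.of F L i x hx) := by
  have hx' := hspan i hi x hx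
  suffices H : ∃ hx : x ∈ gamma F L i,
      basisLead (fun a => f (GrLie.of F L (w a) (b a) (hbw a))) (fun a => (w a : ℕ)) b i x =
        f (GrLie.of F L i x hx) from H.2
  clear hx
  induction hx' using Submodule.span_induction with
  | mem x hx =>
    obtain ⟨e, he : (i : ℕ) ≤ (w e : ℕ), rfl⟩ := hx
    refine ⟨gamma_anti F L he (hbw e), ?_⟩
    rw [basisLead_basis]
    rcases he.lt_or_eq with hlt | heq
    · rw [if_neg hlt.ne', GrLie.of_eq_zero F L _ (gamma_anti F L hlt (hbw e)), map_zero]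
    · rw [if_pos heq.symm]
      exact congrArg f (GrLie.of_congr F L (PNat.eq heq.symm) rfl _ _)
  | zero => exact ⟨zero_mem _, by rw [GrLie.of_zero, map_zero, map_zero]⟩
  | add x y _ _ hx hy =>
    obtain ⟨hx, h⟩ := hx
    obtain ⟨hy, h'⟩ := hy
    exact ⟨add_mem hx hy, by rw [GrLie.of_add, map_add, map_add, h, h']⟩
  | smul c x _ hx =>
    obtain ⟨hx, h⟩ := hx
    exact ⟨(gamma F L i).smul_mem c hx, by rw [GrLie.of_smul, map_smul, map_smul, h]⟩

/-! ### Weights and the powers of the augmentation ideal -/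

section WeightedAction

variable {F L} {B : Type*} [LinearOrder B] {b : Module.Basis B F L} {w : B → ℕ} {N : ℕ}

theorem envAct_mem_wtGE
    (hb : ∀ a c m, m ≤ N → m ≤ w a + w c → ⁅b a, b c⁆ ∈ basisGE w b m)
    (h1 : ∀ x, x ∈ basisGE w b 1) (u : UniversalEnvelopingAlgebra F L) {k : ℕ} (hk : k ≤ N)
    {s : Multiset B →₀ F} (hs : s ∈ wtGE w F k) : envAct b u s ∈ wtGE w F k := by
  induction u using env_induction generalizing s with
  | algebraMap c =>
    rw [AlgHom.commutes]
    exact Submodule.smul_mem _ c hs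
  | ι x =>
    rw [envAct_ι]
    exact act_mem_wtGE hb hk (Nat.le_add_left k 1) (h1 x) hs
  | mul u v hu hv =>
    rw [map_mul]
    exact hu (hv hs)
  | add u v hu hv =>
    rw [map_add]
    exact add_mem (hu hs) (hv hs)

/-- All basis weights are at least 1, so `L` acts as zero on successive quotients of the weight
filtration, and `U(L)` acts there through `ε`. -/
theorem envAct_sub_augmentation_mem_wtGE
    (hb : ∀ a c m, m ≤ N → m ≤ w a + w c → ⁅b a, b c⁆ ∈ basisGE w b m)
    (h1 : ∀ x, x ∈ basisGE w b 1) (u : UniversalEnvelopingAlgebra F L) {k : ℕ} (hk : k < N)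
    {s : Multiset B →₀ F} (hs : s ∈ wtGE w F k) :
    envAct b u s - augmentation F L u • s ∈ wtGE w F (k + 1) := by
  induction u using env_induction with
  | algebraMap c =>
    rw [AlgHom.commutes, AlgHom.commutes, Module.algebraMap_end_apply, Algebra.algebraMap_self,
      RingHom.id_apply, sub_self]
    exact zero_mem _
  | ι x =>
    rw [envAct_ι, augmentation_ι, zero_smul, sub_zero]
    exact act_mem_wtGE hb hk (by omega) (h1 x) hs
  | mul u v hu hv =>
    have h := add_mem (envAct_mem_wtGE hb h1 u hk hv)
      (Submodule.smul_mem _ (augmentation F L v) hu)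
    convert h using 1
    simp only [map_mul, map_sub, map_smul, Module.End.mul_apply, smul_sub, smul_smul,
      mul_comm (augmentation F L u)]
    abel
  | add u v hu hv =>
    convert add_mem hu hv using 1
    simp only [map_add, LinearMap.add_apply, add_smul]
    abel

theorem envAct_omegaPow_mem_wtGE
    (hb : ∀ a c m, m ≤ N → m ≤ w a + w c → ⁅b a, b c⁆ ∈ basisGE w b m)
    (h1 : ∀ x, x ∈ basisGE w b 1) {k : ℕ} (hk : k ≤ N) {u : UniversalEnvelopingAlgebra F L}
    (hu : u ∈ omegaPow F L k) : envAct b u (mon F 0) ∈ wtGE w F k := by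
  induction k generalizing u with
  | zero => exact envAct_mem_wtGE hb h1 u hk (mon_mem_wtGE w (Nat.zero_le _))
  | succ k ih =>
    refine omegaPow_succ_induction F L (fun u hu v hv => ?_) (fun u v hu hv => ?_) hu
    · have h := envAct_sub_augmentation_mem_wtGE hb h1 u hk (ih (by omega) hv)
      rwa [(mem_omegaPow_one F L).1 hu, zero_smul, sub_zero, ← Module.End.mul_apply, ← map_mul] at h
    · rw [map_add]
      exact add_mem hu hv

/-- Iterates `lead_act` along the list; the weight bound is carried along because each application
requires it. -/
theorem lead_envAct_prod
    (hb : ∀ a c m, m ≤ N → m ≤ w a + w c → ⁅b a, b c⁆ ∈ basisGE w b m)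
    (hspan : ∀ i ≤ N, ∀ x ∈ gamma F L i, x ∈ basisGE w b i)
    {A : Type*} [Ring A] [Algebra F A] {v : B → A}
    (hv : ∀ a c, w a + w c < N →
      v a * v c - v c * v a = basisLead v w b (w a + w c) ⁅b a, b c⁆)
    (l : List (Σ i : ℕ+, gamma F L i)) {m : ℕ} (hm : m < N)
    (hl : (l.map fun a => (a.1 : ℕ)).sum = m) :
    envAct b (l.map fun a => UniversalEnvelopingAlgebra.ι F (a.2 : L)).prod (mon F 0) ∈
        wtGE w F m ∧
      lead v F w m (envAct b (l.map fun a => UniversalEnvelopingAlgebra.ι F (a.2 : L)).prod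
        (mon F 0)) = (l.map fun a => basisLead v w b a.1 (a.2 : L)).prod := by
  induction l generalizing m with
  | nil =>
    subst hl
    simp only [List.map_nil, List.prod_nil, List.sum_nil, map_one, Module.End.one_apply]
    refine ⟨mon_mem_wtGE w (Nat.zero_le _), ?_⟩
    rw [lead_mon]
    simp [wt]
  | cons a l ih =>
    rw [List.map_cons, List.sum_cons] at hl
    obtain ⟨h1, h2⟩ := ih (by omega) rfl
    have ha := hspan a.1 (by omega) _ a.2.2
    simp only [List.map_cons, List.prod_cons, map_mul, Module.End.mul_apply, envAct_ι]
    refine ⟨act_mem_wtGE hb (by omega) hl.ge ha h1, ?_⟩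
    rw [lead_act hb hv hl (by omega) ha h1, h2]

end WeightedAction

/-- A left inverse of the degree `n` part of `φ`, defined on representatives. -/
theorem exists_symbol (n : ℕ) :
    ∃ ψ : UniversalEnvelopingAlgebra F L →ₗ[F] UniversalEnvelopingAlgebra F (GrLie F L),
      (∀ u ∈ omegaPow F L (n + 1), ψ u = 0) ∧
      ∀ l : List (Σ i : ℕ+, gamma F L i), (l.map fun a => (a.1 : ℕ)).sum = n →
        ψ (l.map fun a => UniversalEnvelopingAlgebra.ι F (a.2 : L)).prod =
          (l.map fun a => UniversalEnvelopingAlgebra.ι F (GrLie.of F L a.1 a.2 a.2.2)).prod := by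
  classical
  -- The cap `N = n + 1` is the least that lets leading parts be taken in weight `n < N` and `ωⁿ⁺¹`
  -- be detected.
  obtain ⟨B, b, w', hw, hbw, hspan⟩ := exists_adapted_basis
    (fun i => (gamma F L i).toSubmodule) (fun i j h => gamma_anti F L h) rfl (n + 1) (by omega)
  let _ : LinearOrder B := linearOrderOfSTO WellOrderingRel
  obtain ⟨w, rfl⟩ : ∃ w : B → ℕ+, w' = fun a => (w a : ℕ) := ⟨fun a => ⟨w' a, hw a⟩, rfl⟩
  have hspan : ∀ i ≤ n + 1, ∀ x ∈ gamma F L i, x ∈ basisGE (fun a => (w a : ℕ)) b i := hspan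
  have hbw : ∀ a, b a ∈ gamma F L (w a) := hbw
  have h1 : ∀ x : L, x ∈ basisGE (fun a => (w a : ℕ)) b 1 := fun x => hspan 1 (by omega) x trivial
  have hb : ∀ a c m, m ≤ n + 1 → m ≤ (w a : ℕ) + w c → ⁅b a, b c⁆ ∈ basisGE (fun a => (w a : ℕ)) b m :=
    fun a c m hm hmac => hspan m hm _
      (gamma_anti F L hmac (lie_mem_gamma F L (hw a) (hw c) (hbw a) (hbw c)))
  obtain ⟨v, hv⟩ : ∃ v : B → UniversalEnvelopingAlgebra F (GrLie F L), v = fun a =>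
    UniversalEnvelopingAlgebra.ι F (GrLie.of F L (w a) (b a) (hbw a)) := ⟨_, rfl⟩
  have hlead : ∀ (i : ℕ+) (_ : (i : ℕ) ≤ n + 1) (x : L) (hx : x ∈ gamma F L i),
      basisLead v (fun a => (w a : ℕ)) b i x = UniversalEnvelopingAlgebra.ι F (GrLie.of F L i x hx) := by
    intro i hi x hx
    rw [hv]
    exact basisLead_of_mem_gamma hbw hspan
      (UniversalEnvelopingAlgebra.ι F : GrLie F L →ₗ⁅F⁆ _).toLinearMap hi hx
  have hcomm : ∀ a c, (w a : ℕ) + w c < n + 1 →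
      v a * v c - v c * v a = basisLead v (fun a => (w a : ℕ)) b ((w a : ℕ) + w c) ⁅b a, b c⁆ := by
    intro a c hac
    have h := hlead (w a + w c) hac.le _ (lie_mem_gamma_pnat F L (hbw a) (hbw c))
    refine Eq.trans ?_ h.symm
    simp only [hv]
    rw [← LieRing.of_associative_ring_bracket, ← LieHom.map_lie, GrLie.of_lie_of]
  refine ⟨lead v F (fun a => (w a : ℕ)) n ∘ₗ LinearMap.applyₗ (mon F 0) ∘ₗ (envAct b).toLinearMap, ?_, ?_⟩
  · intro u hu
    exact lead_eq_zero v (Nat.lt_succ_self n) (envAct_omegaPow_mem_wtGE hb h1 le_rfl hu)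
  · intro l hl
    refine (lead_envAct_prod hb hspan hcomm l (Nat.lt_succ_self n) hl).2.trans ?_
    refine congrArg List.prod (List.map_congr_left fun a ha => hlead a.1 ?_ a.2 a.2.2)
    have := List.le_sum_of_mem (List.mem_map_of_mem (f := fun a : Σ i : ℕ+, gamma F L i =>
      (a.1 : ℕ)) ha)
    omega

theorem phi_list_prod (l : List (Σ i : ℕ+, gamma F L i)) (n : ℕ)
    (hl : (l.map fun a => (a.1 : ℕ)).sum = n) :
    ∃ h : (l.map fun a => UniversalEnvelopingAlgebra.ι F (a.2 : L)).prod ∈ omegaPow F L n,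
      phi F L (l.map fun a =>
        UniversalEnvelopingAlgebra.ι F (GrLie.of F L a.1 a.2 a.2.2)).prod =
        GrEnv.of F L n (l.map fun a => UniversalEnvelopingAlgebra.ι F (a.2 : L)).prod h := by
  subst hl
  induction l with
  | nil => exact ⟨one_mem_omegaPow_zero F L, map_one _⟩
  | cons a l ih =>
    obtain ⟨h1, h2⟩ := ih
    simp only [List.map_cons, List.prod_cons, List.sum_cons, map_mul]
    refine ⟨mul_mem_omegaPow F L (ι_mem_omegaPow F L a.1.pos a.2.2) h1, ?_⟩
    rw [h2, phi_ι_of, GrEnv.of_mul_of]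

theorem exists_list_of_comp (l : List (Σ i : ℕ+, GrLieComp F L i)) :
    ∃ l' : List (Σ i : ℕ+, gamma F L i),
      (l'.map fun a => (a.1 : ℕ)) = (l.map fun a => (a.1 : ℕ)) ∧
      (l'.map fun a => UniversalEnvelopingAlgebra.ι F (GrLie.of F L a.1 a.2 a.2.2)) =
        l.map fun a => UniversalEnvelopingAlgebra.ι F (GrLie.incl F L a.1 a.2) := by
  induction l with
  | nil => exact ⟨[], rfl, rfl⟩
  | cons a l ih =>
    obtain ⟨l', h1, h2⟩ := ih
    obtain ⟨i, a⟩ := a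
    obtain ⟨x, hx, rfl⟩ := GrLieComp.exists_rep F L a
    exact ⟨⟨i, x, hx⟩ :: l', by rw [List.map_cons, List.map_cons, h1],
      by rw [List.map_cons, List.map_cons, h2]; rfl⟩

@[elab_as_elim]
theorem envDegree_induction {n : ℕ} {p : UniversalEnvelopingAlgebra F (GrLie F L) → Prop}
    (prod : ∀ l : List (Σ i : ℕ+, gamma F L i), (l.map fun a => (a.1 : ℕ)).sum = n →
      p (l.map fun a => UniversalEnvelopingAlgebra.ι F (GrLie.of F L a.1 a.2 a.2.2)).prod)
    (zero : p 0) (add : ∀ x y, p x → p y → p (x + y)) (smul : ∀ (c : F) x, p x → p (c • x))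
    {x : UniversalEnvelopingAlgebra F (GrLie F L)} (hx : x ∈ envDegree F L n) : p x := by
  induction hx using Submodule.span_induction with
  | mem x hx =>
    obtain ⟨l, hl, rfl⟩ := hx
    obtain ⟨l', h1, h2⟩ := exists_list_of_comp F L l
    rw [← h2]
    exact prod l' (by rw [h1, hl])
  | zero => exact zero
  | add x y _ _ hx hy => exact add x y hx hy
  | smul c x _ hx => exact smul c x hx

/-! ### The grading of `U(gr L)` and its image under `φ` -/

theorem one_mem_envDegree : 1 ∈ envDegree F L 0 :=
  Submodule.subset_span ⟨[], rfl, rfl⟩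

theorem mul_mem_envDegree {m n : ℕ} {x y : UniversalEnvelopingAlgebra F (GrLie F L)}
    (hx : x ∈ envDegree F L m) (hy : y ∈ envDegree F L n) : x * y ∈ envDegree F L (m + n) := by
  have : envDegree F L m * envDegree F L n ≤ envDegree F L (m + n) := by
    rw [envDegree, envDegree, Submodule.span_mul_span, Submodule.span_le]
    rintro _ ⟨_, ⟨l, hl, rfl⟩, _, ⟨l', hl', rfl⟩, rfl⟩
    exact Submodule.subset_span ⟨l ++ l', by simp [hl, hl'], by simp⟩
  exact this (Submodule.mul_mem_mul hx hy)

instance : SetLike.GradedMonoid (envDegree F L) where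
  one_mem := one_mem_envDegree F L
  mul_mem _ _ _ _ hx hy := mul_mem_envDegree F L hx hy

theorem iSup_envDegree : iSup (envDegree F L) = ⊤ := by
  rw [eq_top_iff]
  rintro u -
  induction u using env_induction with
  | algebraMap c =>
    rw [Algebra.algebraMap_eq_smul_one]
    exact Submodule.smul_mem _ c (Submodule.mem_iSup_of_mem 0 (one_mem_envDegree F L))
  | ι x =>
    induction x using GrLie.induction_of with
    | h0 => rw [map_zero]; exact zero_mem _
    | hof i x hx =>
      refine Submodule.mem_iSup_of_mem (i : ℕ) (Submodule.subset_span
        ⟨[⟨i, GrLieComp.mk F L i x hx⟩], by simp, ?_⟩)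
      rw [List.map_singleton, List.prod_singleton]
      rfl
    | hadd x y hx hy => rw [map_add]; exact add_mem hx hy
  | mul u v hu hv =>
    induction hu using Submodule.iSup_induction' with
    | zero => rw [zero_mul]; exact zero_mem _
    | add x y _ _ hx hy => rw [add_mul]; exact add_mem hx hy
    | mem m x hx =>
      induction hv using Submodule.iSup_induction' with
      | zero => rw [mul_zero]; exact zero_mem _
      | add x y _ _ hx hy => rw [mul_add]; exact add_mem hx hy
      | mem n y hy => exact Submodule.mem_iSup_of_mem (m + n) (mul_mem_envDegree F L hx hy)
  | add u v hu hv => exact add_mem hu hv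

theorem phi_mem_degree {n : ℕ} {u : UniversalEnvelopingAlgebra F (GrLie F L)}
    (hu : u ∈ envDegree F L n) : phi F L u ∈ GrEnv.degree F L n := by
  refine envDegree_induction F L (fun l hl => ?_) ?_ (fun x y hx hy => ?_) (fun c x hx => ?_) hu
  · obtain ⟨h, h'⟩ := phi_list_prod F L l n hl
    exact ⟨_, h'.symm⟩
  · rw [map_zero]; exact zero_mem _
  · rw [map_add]; exact add_mem hx hy
  · rw [map_smul]; exact Submodule.smul_mem _ c hx

/-- The maps of `exists_symbol` glue to a left inverse `Ψ`. It is enough to check this on products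
of homogeneous elements, which span `U(gr L)`; no basis of `U(gr L)` is needed. -/
theorem phi_injective : Function.Injective (phi F L) := by
  choose ψ hψ hψ' using exists_symbol F L
  let Ψ : GrEnv F L →ₗ[F] UniversalEnvelopingAlgebra F (GrLie F L) :=
    DirectSum.toModule F ℕ _ fun n =>
      ((omegaPow F L (n + 1)).submoduleOf (omegaPow F L n)).liftQ
        (ψ n ∘ₗ (omegaPow F L n).subtype) fun x hx => hψ n x hx
  have hΨ : ∀ n x hx, Ψ (GrEnv.of F L n x hx) = ψ n x := fun n x hx =>
    DirectSum.toModule_lof F (φ := fun n =>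
      ((omegaPow F L (n + 1)).submoduleOf (omegaPow F L n)).liftQ
        (ψ n ∘ₗ (omegaPow F L n).subtype) fun x hx => hψ n x hx) n (GrEnvComp.mk F L n x hx)
  refine Function.LeftInverse.injective (g := Ψ) fun u => ?_
  have hu : u ∈ iSup (envDegree F L) := by rw [iSup_envDegree]; trivial
  induction hu using Submodule.iSup_induction' with
  | zero => simp
  | add x y _ _ hx hy => rw [map_add, map_add, hx, hy]
  | mem n x hx =>
    refine envDegree_induction F L (fun l hl => ?_) ?_ (fun x y hx hy => ?_) (fun c x hx => ?_) hx
    · obtain ⟨h, h'⟩ := phi_list_prod F L l n hl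
      rw [h', hΨ, hψ' n l hl]
    · simp
    · rw [map_add, map_add, hx, hy]
    · rw [map_smul, map_smul, hx]

theorem GrEnv.of_add (n : ℕ) (x y : UniversalEnvelopingAlgebra F L)
    (hx : x ∈ omegaPow F L n) (hy : y ∈ omegaPow F L n) :
    GrEnv.of F L n (x + y) (add_mem hx hy) = GrEnv.of F L n x hx + GrEnv.of F L n y hy :=
  map_add (DirectSum.lof F ℕ (GrEnvComp F L) n) (GrEnvComp.mk F L n x hx)
    (GrEnvComp.mk F L n y hy)

theorem GrEnv.of_eq_of_sub_mem {n : ℕ} {x y : UniversalEnvelopingAlgebra F L}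
    (hx : x ∈ omegaPow F L n) (hy : y ∈ omegaPow F L n) (h : x - y ∈ omegaPow F L (n + 1)) :
    GrEnv.of F L n x hx = GrEnv.of F L n y hy := by
  rw [← sub_eq_zero, ← GrEnv.of_sub, GrEnv.of, (GrEnvComp.mk_eq_zero_iff F L _).2 h, map_zero]

theorem mem_gamma_one (x : L) : x ∈ gamma F L ((1 : ℕ+) : ℕ) := by
  rw [PNat.one_coe, gamma_one]
  trivial

/-- In `ωⁿ⁺¹ = ω ωⁿ` the first factor may be replaced by an element of `L` modulo `ω²`, which
changes the product only by an element of `ωⁿ⁺²`. -/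
theorem of_mem_map_phi (n : ℕ) {x : UniversalEnvelopingAlgebra F L} (hx : x ∈ omegaPow F L n) :
    GrEnv.of F L n x hx ∈ (envDegree F L n).map (phi F L).toLinearMap := by
  induction n generalizing x with
  | zero =>
    refine ⟨algebraMap F _ (augmentation F L x), ?_, ?_⟩
    · rw [Algebra.algebraMap_eq_smul_one]
      exact Submodule.smul_mem _ _ (one_mem_envDegree F L)
    · rw [GrEnv.of_eq_of_sub_mem F L hx (mem_omegaPow_zero F L _) (sub_augmentation_mem F L x)]
      change phi F L (algebraMap F _ (augmentation F L x)) = _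
      rw [AlgHom.commutes]
      exact GrEnv.of_congr F L rfl (Algebra.algebraMap_eq_smul_one _).symm
        (Submodule.smul_mem _ _ (one_mem_omegaPow_zero F L)) _
  | succ n ih =>
    suffices H : ∃ hx : x ∈ omegaPow F L (n + 1), GrEnv.of F L (n + 1) x hx ∈
        (envDegree F L (n + 1)).map (phi F L).toLinearMap from H.2
    refine omegaPow_succ_induction F L (fun u hu v hv => ?_) (fun u v hu hv => ?_) hx
    · obtain ⟨y, hy⟩ := exists_ι_sub_mem_of_mem F L hu
      obtain ⟨z, hz, hz'⟩ := ih hv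
      have huv : u * v ∈ omegaPow F L (n + 1) := by
        rw [add_comm]; exact mul_mem_omegaPow F L hu hv
      refine ⟨huv, UniversalEnvelopingAlgebra.ι F (GrLie.of F L 1 y (mem_gamma_one F L y)) * z, ?_, ?_⟩
      · rw [add_comm]
        refine mul_mem_envDegree F L (Submodule.subset_span
          ⟨[⟨1, GrLieComp.mk F L 1 y (mem_gamma_one F L y)⟩], by simp, ?_⟩) hz
        rw [List.map_singleton, List.prod_singleton]
        rfl
      · change phi F L (_ * z) = _
        change phi F L z = _ at hz'
        rw [map_mul, hz', phi_ι_of]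
        have := GrEnv.of_eq_of_sub_mem F L hu (ι_mem_omegaPow F L (n := 1) le_rfl trivial) hy
        refine (congrArg (· * _) this.symm).trans ?_
        rw [GrEnv.of_mul_of]
        exact GrEnv.of_congr F L (add_comm 1 n) rfl _ _
    · obtain ⟨hu, hu'⟩ := hu
      obtain ⟨hv, hv'⟩ := hv
      exact ⟨add_mem hu hv, by rw [GrEnv.of_add F L _ _ _ hu hv]; exact add_mem hu' hv'⟩

theorem map_phi_envDegree (n : ℕ) :
    (envDegree F L n).map (phi F L).toLinearMap = GrEnv.degree F L n := by
  refine le_antisymm ?_ ?_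
  · rintro _ ⟨u, hu, rfl⟩
    exact phi_mem_degree F L hu
  · rintro _ ⟨a, rfl⟩
    obtain ⟨x, hx, rfl⟩ := GrEnvComp.exists_rep F L a
    exact of_mem_map_phi F L n hx

theorem phi_surjective : Function.Surjective (phi F L) := by
  intro y
  rw [← AlgHom.coe_toLinearMap, ← Set.mem_range, ← LinearMap.coe_range]
  induction y using DirectSum.induction_on with
  | zero => exact zero_mem _
  | of n a =>
    have h : DirectSum.lof F ℕ (GrEnvComp F L) n a ∈ GrEnv.degree F L n := ⟨a, rfl⟩
    rw [← map_phi_envDegree] at h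
    exact LinearMap.map_le_range h
  | add x y hx hy => exact add_mem hx hy

theorem phi_apply_of_ne {m n : ℕ} (h : m ≠ n) {u : UniversalEnvelopingAlgebra F (GrLie F L)}
    (hu : u ∈ envDegree F L m) : phi F L u n = 0 := by
  obtain ⟨a, ha⟩ := phi_mem_degree F L hu
  rw [← ha, DirectSum.lof_eq_of]
  exact DirectSum.of_eq_of_ne m n a h.symm

/-- Independence is inherited from `gr U(L)`: `φ` is injective and respects degrees, so components
can be compared after applying it. -/
theorem isInternal_envDegree : DirectSum.IsInternal (envDegree F L) := by
  classical
  refine ⟨?_, ?_⟩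
  · rw [injective_iff_map_eq_zero]
    intro x hx
    have key : ∀ n, phi F L (DirectSum.coeAddMonoidHom (envDegree F L) x) n =
        phi F L (x n) n := by
      intro n
      clear hx
      induction x using DirectSum.induction_on with
      | zero => simp
      | add x y hx hy => simp only [map_add, DirectSum.add_apply, hx, hy, Submodule.coe_add]
      | of m a =>
        rw [DirectSum.coeAddMonoidHom_of]
        rcases eq_or_ne m n with rfl | h
        · rw [DirectSum.of_eq_same]
        · rw [phi_apply_of_ne F L h a.2, DirectSum.of_eq_of_ne (β := fun i => envDegree F L i)
            m n a h.symm, ZeroMemClass.coe_zero, map_zero, DirectSum.zero_apply]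
    ext n
    rw [DirectSum.zero_apply, ZeroMemClass.coe_zero]
    apply phi_injective F L
    rw [map_zero]
    refine DFinsupp.ext fun m => ?_
    rcases eq_or_ne n m with rfl | h
    · exact (key n).symm.trans (by rw [hx, map_zero])
    · exact phi_apply_of_ne F L h (x n).2
  · exact (DirectSum.range_coeLinearMap (A := envDegree F L) ▸ iSup_envDegree F L :
      LinearMap.range (DirectSum.coeLinearMap (envDegree F L)) = ⊤) |> LinearMap.range_eq_top.1

theorem nonempty_gradedAlgebra_envDegree : Nonempty (GradedAlgebra (envDegree F L)) := by
  classical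
  exact ⟨{ (isInternal_envDegree F L).chooseDecomposition with }⟩

/-! ### Invariants of the enveloping algebra -/

section Augmentation

variable {F : Type u} [Field F] {L : Type v} [LieRing L] [LieAlgebra F L]
  {H : Type v'} [LieRing H] [LieAlgebra F H]

/-- The automorphism `x ↦ x + c(x)` of `U(L)` given by a character `c` of `L`. -/
noncomputable def shift (c : L →ₗ[F] F) (hc : ∀ x y : L, c ⁅x, y⁆ = 0) :
    UniversalEnvelopingAlgebra F L →ₐ[F] UniversalEnvelopingAlgebra F L :=
  UniversalEnvelopingAlgebra.lift F
    { (UniversalEnvelopingAlgebra.ι F : L →ₗ⁅F⁆ _).toLinearMap + Algebra.linearMap F _ ∘ₗ c with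
      map_lie' := fun {x y} => by
        change UniversalEnvelopingAlgebra.ι F ⁅x, y⁆ + algebraMap F _ (c ⁅x, y⁆) =
          ⁅UniversalEnvelopingAlgebra.ι F x + algebraMap F _ (c x),
            UniversalEnvelopingAlgebra.ι F y + algebraMap F _ (c y)⁆
        rw [LieHom.map_lie, hc, map_zero, add_zero]
        simp only [LieRing.of_associative_ring_bracket, mul_add, add_mul]
        rw [Algebra.commutes (c x) (UniversalEnvelopingAlgebra.ι F y),
          Algebra.commutes (c y) (UniversalEnvelopingAlgebra.ι F x),
          Algebra.commutes (c x) (algebraMap F _ (c y))]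
        abel }

theorem shift_ι (c : L →ₗ[F] F) (hc : ∀ x y : L, c ⁅x, y⁆ = 0) (x : L) :
    shift c hc (UniversalEnvelopingAlgebra.ι F x) =
      UniversalEnvelopingAlgebra.ι F x + algebraMap F _ (c x) :=
  UniversalEnvelopingAlgebra.lift_ι_apply F _ x

theorem shift_shift (c c' : L →ₗ[F] F) (hc : ∀ x y : L, c ⁅x, y⁆ = 0) (hc' : ∀ x y : L, c' ⁅x, y⁆ = 0)
    (h : ∀ x, c x + c' x = 0) (u : UniversalEnvelopingAlgebra F L) :
    shift c hc (shift c' hc' u) = u := by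
  have : (shift c hc).comp (shift c' hc') = AlgHom.id F _ := by
    refine UniversalEnvelopingAlgebra.hom_ext F (LieHom.ext fun x => ?_)
    change shift c hc (shift c' hc' (UniversalEnvelopingAlgebra.ι F x)) =
      UniversalEnvelopingAlgebra.ι F x
    rw [shift_ι, map_add, shift_ι, AlgHom.commutes, add_assoc, ← map_add, h, map_zero, add_zero]
  exact AlgHom.congr_fun this u

theorem augmentation_comp_eq_of_ι
    (g : UniversalEnvelopingAlgebra F L →ₐ[F] UniversalEnvelopingAlgebra F H)
    (h : ∀ x, augmentation F H (g (UniversalEnvelopingAlgebra.ι F x)) = 0)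
    (u : UniversalEnvelopingAlgebra F L) : augmentation F H (g u) = augmentation F L u := by
  have : (augmentation F H).comp g = augmentation F L := by
    refine UniversalEnvelopingAlgebra.hom_ext F (LieHom.ext fun x => ?_)
    change augmentation F H (g (UniversalEnvelopingAlgebra.ι F x)) =
      augmentation F L (UniversalEnvelopingAlgebra.ι F x)
    rw [h, augmentation_ι]
  exact AlgHom.congr_fun this u

/-- Isomorphic enveloping algebras are isomorphic as augmented algebras. -/
theorem exists_augmented_equiv
    (f : UniversalEnvelopingAlgebra F L ≃ₐ[F] UniversalEnvelopingAlgebra F H) :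
    ∃ g : UniversalEnvelopingAlgebra F L ≃ₐ[F] UniversalEnvelopingAlgebra F H,
      ∀ u, augmentation F H (g u) = augmentation F L u := by
  -- The augmentation of `H` pulled back along `f` is a character of `L`, as `F` is commutative;
  -- precomposing `f` with the shift by `-c` cancels it.
  let c : L →ₗ[F] F := (augmentation F H).toLinearMap ∘ₗ f.toLinearMap ∘ₗ
    (UniversalEnvelopingAlgebra.ι F : L →ₗ⁅F⁆ _).toLinearMap
  have hc : ∀ x, c x = augmentation F H (f (UniversalEnvelopingAlgebra.ι F x)) := fun x => rfl
  have hc₁ : ∀ x y : L, c ⁅x, y⁆ = 0 := fun x y => by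
    rw [hc, LieHom.map_lie, LieRing.of_associative_ring_bracket]
    simp only [map_sub, map_mul]
    rw [mul_comm, sub_self]
  have hc₂ : ∀ x y : L, (-c) ⁅x, y⁆ = 0 := fun x y => by rw [LinearMap.neg_apply, hc₁, neg_zero]
  let e : UniversalEnvelopingAlgebra F L ≃ₐ[F] UniversalEnvelopingAlgebra F L :=
    AlgEquiv.ofAlgHom (shift (-c) hc₂) (shift c hc₁)
      (AlgHom.ext fun u => shift_shift (-c) c hc₂ hc₁ (fun x => neg_add_cancel (c x)) u)
      (AlgHom.ext fun u => shift_shift c (-c) hc₁ hc₂ (fun x => add_neg_cancel (c x)) u)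
  refine ⟨e.trans f, augmentation_comp_eq_of_ι (e.trans f).toAlgHom fun x => ?_⟩
  change augmentation F H (f (shift (-c) hc₂ (UniversalEnvelopingAlgebra.ι F x))) = 0
  rw [shift_ι, map_add, map_add, ← hc, AlgEquiv.commutes, AlgHom.commutes]
  exact add_neg_cancel (c x)

/-! ### Transport of `gr L` along an augmented homomorphism -/

theorem map_mem_omegaPow
    {g : UniversalEnvelopingAlgebra F L →ₐ[F] UniversalEnvelopingAlgebra F H}
    (hg : ∀ u, augmentation F H (g u) = augmentation F L u) {n : ℕ}
    {u : UniversalEnvelopingAlgebra F L} (hu : u ∈ omegaPow F L n) : g u ∈ omegaPow F H n := by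
  induction n generalizing u with
  | zero => exact mem_omegaPow_zero F H _
  | succ n ih =>
    refine omegaPow_succ_induction F L (fun u hu v hv => ?_) (fun u v hu hv => ?_) hu
    · rw [map_mul, add_comm]
      refine mul_mem_omegaPow F H ?_ (ih hv)
      rwa [mem_omegaPow_one, hg, ← mem_omegaPow_one]
    · rw [map_add]
      exact add_mem hu hv

/-- The composite `gr L → U(gr L) → gr U(L)` is injective: the first map by Poincaré–Birkhoff–Witt
for `gr L`, the second by `phi_injective`. So the class of `x` vanishes once its image does. -/
theorem mem_gamma_succ_of_ι_mem (i : ℕ+) {x : L} (hx : x ∈ gamma F L i)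
    (h : UniversalEnvelopingAlgebra.ι F x ∈ omegaPow F L (i + 1)) : x ∈ gamma F L (i + 1) := by
  rw [← GrLieComp.mk_eq_zero_iff F L hx]
  have h0 : GrLie.of F L i x hx = 0 := by
    apply ι_injective (R := F)
    apply phi_injective F L
    rw [phi_ι_of, map_zero, map_zero, GrEnv.of, (GrEnvComp.mk_eq_zero_iff F L _).2 h, map_zero]
  exact DirectSum.of_injective (β := GrLieComp F L) i (h0.trans (map_zero _).symm)

theorem lie_sub_mem_omegaPow {i j : ℕ} {a a' b b' : UniversalEnvelopingAlgebra F H}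
    (ha : a - a' ∈ omegaPow F H (i + 1)) (ha' : a' ∈ omegaPow F H i)
    (hb : b - b' ∈ omegaPow F H (j + 1)) (hb' : b' ∈ omegaPow F H j) :
    ⁅a, b⁆ - ⁅a', b'⁆ ∈ omegaPow F H (i + j + 1) := by
  have hb2 : b ∈ omegaPow F H j := by
    rw [← sub_add_cancel b b']
    exact add_mem (omegaPow_succ_le F H j hb) hb'
  have h1 : (a - a') * b ∈ omegaPow F H (i + j + 1) := by
    rw [add_right_comm]; exact mul_mem_omegaPow F H ha hb2
  have h2 : b * (a - a') ∈ omegaPow F H (i + j + 1) := by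
    rw [add_comm i j, add_assoc]; exact mul_mem_omegaPow F H hb2 ha
  have h3 : a' * (b - b') ∈ omegaPow F H (i + j + 1) := by
    rw [add_assoc]; exact mul_mem_omegaPow F H ha' hb
  have h4 : (b - b') * a' ∈ omegaPow F H (i + j + 1) := by
    rw [add_comm i j, add_right_comm]; exact mul_mem_omegaPow F H hb ha'
  convert add_mem (sub_mem h1 h2) (sub_mem h3 h4) using 1
  simp only [LieRing.of_associative_ring_bracket]
  noncomm_ring

/-- In degree one this is `ω = L + ω²`. Higher terms are spanned by brackets, and the brackets of
approximations approximate the brackets. -/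
theorem exists_gamma_rep
    {g : UniversalEnvelopingAlgebra F L →ₐ[F] UniversalEnvelopingAlgebra F H}
    (hg : ∀ u, augmentation F H (g u) = augmentation F L u) {i : ℕ} (hi : 1 ≤ i) {x : L}
    (hx : x ∈ gamma F L i) :
    ∃ y ∈ gamma F H i, g (UniversalEnvelopingAlgebra.ι F x) - UniversalEnvelopingAlgebra.ι F y ∈
      omegaPow F H (i + 1) := by
  have hone : ∀ x : L, ∃ y : H, g (UniversalEnvelopingAlgebra.ι F x) -
      UniversalEnvelopingAlgebra.ι F y ∈ omegaPow F H 2 := fun x =>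
    exists_ι_sub_mem_of_mem F H (map_mem_omegaPow hg (ι_mem_omegaPow F L le_rfl (by trivial)))
  induction i, hi using Nat.le_induction generalizing x with
  | base =>
    obtain ⟨y, hy⟩ := hone x
    exact ⟨y, trivial, hy⟩
  | succ i hi ih =>
    rw [gamma_succ F L i hi, ← LieSubmodule.mem_toSubmodule,
      LieSubmodule.lieIdeal_oper_eq_linear_span'] at hx
    induction hx using Submodule.span_induction with
    | mem x hx =>
      obtain ⟨a, ha, b, -, rfl⟩ := hx
      obtain ⟨a', ha', haa'⟩ := ih ha
      obtain ⟨b', hbb'⟩ := hone b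
      refine ⟨⁅a', b'⁆, lie_mem_gamma F H hi le_rfl ha' trivial, ?_⟩
      rw [LieHom.map_lie, LieHom.map_lie, LieRing.of_associative_ring_bracket, map_sub, map_mul,
        map_mul, ← LieRing.of_associative_ring_bracket]
      exact lie_sub_mem_omegaPow haa' (ι_mem_omegaPow F H hi ha') hbb'
        (ι_mem_omegaPow F H le_rfl (by trivial))
    | zero => exact ⟨0, zero_mem _, by simp only [map_zero, sub_self, zero_mem]⟩
    | add x y _ _ hx hy =>
      obtain ⟨x', hx', hxx'⟩ := hx
      obtain ⟨y', hy', hyy'⟩ := hy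
      refine ⟨x' + y', add_mem hx' hy', ?_⟩
      simp only [map_add, add_sub_add_comm]
      exact add_mem hxx' hyy'
    | smul c x _ hx =>
      obtain ⟨x', hx', hxx'⟩ := hx
      refine ⟨c • x', (gamma F H (i + 1)).smul_mem c hx', ?_⟩
      simp only [map_smul, ← smul_sub]
      exact Submodule.smul_mem _ c hxx'

theorem GrLieComp.mk_eq_of_ι_sub_mem (i : ℕ+) {x y : L} (hx : x ∈ gamma F L i)
    (hy : y ∈ gamma F L i) (h : UniversalEnvelopingAlgebra.ι F x -
      UniversalEnvelopingAlgebra.ι F y ∈ omegaPow F L (i + 1)) :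
    GrLieComp.mk F L i x hx = GrLieComp.mk F L i y hy := by
  rw [← sub_eq_zero]
  refine (GrLieComp.mk_eq_zero_iff F L (sub_mem hx hy)).2
    (mem_gamma_succ_of_ι_mem i (sub_mem hx hy) ?_)
  rwa [map_sub]

/-- An augmented algebra homomorphism `U(L) → U(H)` induces maps of the components of `gr L` and
`gr H`, determined on the classes of `x ∈ γᵢ(L)` by `g(x)` modulo `ωⁱ⁺¹(H)`. -/
theorem exists_grLieComp_map
    {g : UniversalEnvelopingAlgebra F L →ₐ[F] UniversalEnvelopingAlgebra F H}
    (hg : ∀ u, augmentation F H (g u) = augmentation F L u) (i : ℕ+) :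
    ∃ e : GrLieComp F L i →ₗ[F] GrLieComp F H i, ∀ x y hx hy,
      g (UniversalEnvelopingAlgebra.ι F x) - UniversalEnvelopingAlgebra.ι F y ∈
        omegaPow F H (i + 1) → e (GrLieComp.mk F L i x hx) = GrLieComp.mk F H i y hy := by
  -- The choice `t` need not be linear, but by `key` its class modulo `γᵢ₊₁(H)` does not depend on
  -- the choice, and so it is.
  choose t ht ht' using fun x : gamma F L i => exists_gamma_rep hg i.pos x.2
  have key : ∀ (x : gamma F L i) (y : H) (hy : y ∈ gamma F H i),
      g (UniversalEnvelopingAlgebra.ι F (x : L)) - UniversalEnvelopingAlgebra.ι F y ∈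
        omegaPow F H (i + 1) →
      GrLieComp.mk F H i (t x) (ht x) = GrLieComp.mk F H i y hy := by
    intro x y hy h
    refine GrLieComp.mk_eq_of_ι_sub_mem i _ _ ?_
    convert sub_mem h (ht' x) using 1
    abel
  let e : (gamma F L i).toSubmodule →ₗ[F] GrLieComp F H i :=
    { toFun := fun x => GrLieComp.mk F H i (t x) (ht x)
      map_add' := fun x y => key _ _ (add_mem (ht x) (ht y)) <| by
        rw [LieSubmodule.coe_add, map_add, map_add, map_add, add_sub_add_comm]
        exact add_mem (ht' x) (ht' y)
      map_smul' := fun c x => key _ _ ((gamma F H i).smul_mem c (ht x)) <| by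
        rw [LieSubmodule.coe_smul, map_smul, map_smul, map_smul, ← smul_sub]
        exact Submodule.smul_mem _ c (ht' x) }
  refine ⟨((gamma F L (i + 1)).toSubmodule.submoduleOf (gamma F L i).toSubmodule).liftQ e
    fun x hx => ?_, fun x y hx hy h => key ⟨x, hx⟩ y hy h⟩
  refine (key x 0 (zero_mem _) ?_).trans ((GrLieComp.mk_eq_zero_iff F H _).2 (zero_mem _))
  rw [map_zero, sub_zero]
  exact map_mem_omegaPow hg (ι_mem_omegaPow F L (Nat.le_add_left 1 i) hx)

theorem exists_grLie_hom
    {g : UniversalEnvelopingAlgebra F L →ₐ[F] UniversalEnvelopingAlgebra F H}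
    (hg : ∀ u, augmentation F H (g u) = augmentation F L u) :
    ∃ e : GrLie F L →ₗ⁅F⁆ GrLie F H, ∀ (i : ℕ+) x y hx hy,
      g (UniversalEnvelopingAlgebra.ι F x) - UniversalEnvelopingAlgebra.ι F y ∈
        omegaPow F H (i + 1) → e (GrLie.of F L i x hx) = GrLie.of F H i y hy := by
  choose e he using exists_grLieComp_map hg
  let E : GrLie F L →ₗ[F] GrLie F H :=
    DirectSum.toModule F ℕ+ _ fun i => GrLie.incl F H i ∘ₗ e i
  have hE : ∀ (i : ℕ+) x y hx hy, g (UniversalEnvelopingAlgebra.ι F x) -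
      UniversalEnvelopingAlgebra.ι F y ∈ omegaPow F H (i + 1) →
        E (GrLie.of F L i x hx) = GrLie.of F H i y hy := by
    intro i x y hx hy h
    refine (DirectSum.toModule_lof F (φ := fun i => GrLie.incl F H i ∘ₗ e i) i
      (GrLieComp.mk F L i x hx)).trans ?_
    rw [LinearMap.comp_apply, he i x y hx hy h]
    rfl
  refine ⟨{ E with map_lie' := fun {x y} => ?_ }, hE⟩
  change E ⁅x, y⁆ = ⁅E x, E y⁆
  induction x using GrLie.induction_of with
  | h0 => simp
  | hadd x x' hx hx' => simp only [add_lie, map_add, hx, hx']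
  | hof i x hx =>
  induction y using GrLie.induction_of with
  | h0 => simp
  | hadd y y' hy hy' => simp only [lie_add, map_add, hy, hy']
  | hof j y hy =>
  obtain ⟨x', hx', hxx'⟩ := exists_gamma_rep hg i.pos hx
  obtain ⟨y', hy', hyy'⟩ := exists_gamma_rep hg j.pos hy
  rw [GrLie.of_lie_of, hE i x x' hx hx' hxx', hE j y y' hy hy' hyy', GrLie.of_lie_of]
  refine hE _ _ _ _ _ ?_
  rw [LieHom.map_lie, LieHom.map_lie, LieRing.of_associative_ring_bracket, map_sub, map_mul,
    map_mul, ← LieRing.of_associative_ring_bracket]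
  exact lie_sub_mem_omegaPow hxx' (ι_mem_omegaPow F H i.pos hx') hyy'
    (ι_mem_omegaPow F H j.pos hy')

theorem exists_grLie_equiv
    (f : UniversalEnvelopingAlgebra F L ≃ₐ[F] UniversalEnvelopingAlgebra F H) :
    ∃ e : GrLie F L ≃ₗ⁅F⁆ GrLie F H, ∀ i : ℕ+,
      (GrLie.degree F L i).map (e : GrLie F L →ₗ[F] _) = GrLie.degree F H i := by
  obtain ⟨g, hg⟩ := exists_augmented_equiv f
  have hg' : ∀ u, augmentation F L (g.symm u) = augmentation F H u := fun u => by
    rw [← hg, AlgEquiv.apply_symm_apply]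
  obtain ⟨e, he⟩ := exists_grLie_hom (g := g.toAlgHom) hg
  obtain ⟨e', he'⟩ := exists_grLie_hom (g := g.symm.toAlgHom) hg'
  -- the classes of `x` and `y` correspond to each other
  have hL : ∀ i x hx, ∃ y hy, e (GrLie.of F L i x hx) = GrLie.of F H i y hy ∧
      e' (GrLie.of F H i y hy) = GrLie.of F L i x hx := by
    intro i x hx
    obtain ⟨y, hy, h⟩ := exists_gamma_rep (g := g.toAlgHom) hg i.pos hx
    refine ⟨y, hy, he i x y hx hy h, he' i y x hy hx ?_⟩
    -- Applying the inverse of `g` to `g(x) - y ∈ ωⁱ⁺¹(H)` shows that `x` approximates the image of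
    -- `y` in turn.
    have := neg_mem (map_mem_omegaPow (g := g.symm.toAlgHom) hg' h)
    rw [map_sub, neg_sub] at this
    convert this using 2
    exact (g.symm_apply_apply _).symm
  have hH : ∀ i y hy, ∃ x hx, e' (GrLie.of F H i y hy) = GrLie.of F L i x hx ∧
      e (GrLie.of F L i x hx) = GrLie.of F H i y hy := by
    intro i y hy
    obtain ⟨x, hx, h⟩ := exists_gamma_rep (g := g.symm.toAlgHom) hg' i.pos hy
    refine ⟨x, hx, he' i y x hy hx h, he i x y hx hy ?_⟩
    have := neg_mem (map_mem_omegaPow (g := g.toAlgHom) hg h)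
    rw [map_sub, neg_sub] at this
    convert this using 2
    exact (g.apply_symm_apply _).symm
  have h1 : e'.toLinearMap ∘ₗ e.toLinearMap = LinearMap.id := by
    refine GrLie.ext_of F L fun i x hx => ?_
    obtain ⟨y, hy, h, h'⟩ := hL i x hx
    exact (congrArg e' h).trans h'
  have h2 : e.toLinearMap ∘ₗ e'.toLinearMap = LinearMap.id := by
    refine GrLie.ext_of F H fun i y hy => ?_
    obtain ⟨x, hx, h, h'⟩ := hH i y hy
    exact (congrArg e h).trans h'
  refine ⟨{ e with
    invFun := e'
    left_inv := LinearMap.congr_fun h1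
    right_inv := LinearMap.congr_fun h2 }, fun i => le_antisymm ?_ ?_⟩
  · rintro _ ⟨_, ⟨a, rfl⟩, rfl⟩
    obtain ⟨x, hx, rfl⟩ := GrLieComp.exists_rep F L a
    obtain ⟨y, hy, h, -⟩ := hL i x hx
    exact ⟨GrLieComp.mk F H i y hy, h.symm⟩
  · rintro _ ⟨a, rfl⟩
    obtain ⟨y, hy, rfl⟩ := GrLieComp.exists_rep F H a
    obtain ⟨x, hx, -, h⟩ := hH i y hy
    exact ⟨GrLie.of F L i x hx, ⟨GrLieComp.mk F L i x hx, rfl⟩, h⟩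

end Augmentation

/-! ### The quotients `γₙ/γₘ₊ₙ` -/

section Quotients

theorem SubQuot.subsingleton_self {F M : Type*} [Field F] [AddCommGroup M] [Module F M]
    (P : Submodule F M) : Subsingleton (SubQuot P P) := by
  refine subsingleton_of_forall_eq 0 fun a => ?_
  obtain ⟨x, hx, rfl⟩ := SubQuot.exists_rep a
  exact (SubQuot.mk_eq_zero_iff F hx).2 hx

/-- The sequence `0 → Q/R → P/R → P/Q → 0` is exact, and splits over a field. -/
theorem SubQuot.nonempty_equiv_prod {F M : Type*} [Field F] [AddCommGroup M] [Module F M]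
    {P Q R : Submodule F M} (hQP : Q ≤ P) (hRQ : R ≤ Q) :
    Nonempty (SubQuot P R ≃ₗ[F] SubQuot P Q × SubQuot Q R) := by
  let f : SubQuot Q R →ₗ[F] SubQuot P R :=
    Submodule.mapQ _ _ (Submodule.inclusion hQP) fun x hx => hx
  let g : SubQuot P R →ₗ[F] SubQuot P Q := Submodule.factor fun x hx => hRQ hx
  have hf : Function.Injective f := by
    rw [← LinearMap.ker_eq_bot, LinearMap.ker_eq_bot']
    intro a ha
    obtain ⟨x, hx, rfl⟩ := SubQuot.exists_rep a
    exact (SubQuot.mk_eq_zero_iff F hx).2 ((SubQuot.mk_eq_zero_iff F (hQP hx)).1 ha)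
  have hg : Function.Surjective g := by
    intro a
    obtain ⟨x, hx, rfl⟩ := SubQuot.exists_rep a
    exact ⟨SubQuot.mk x hx, rfl⟩
  have hfg : LinearMap.ker g = LinearMap.range f := by
    apply le_antisymm
    · intro a ha
      obtain ⟨x, hx, rfl⟩ := SubQuot.exists_rep a
      exact ⟨SubQuot.mk x ((SubQuot.mk_eq_zero_iff F hx).1 ha), rfl⟩
    · rintro _ ⟨a, rfl⟩
      obtain ⟨x, hx, rfl⟩ := SubQuot.exists_rep a
      exact (SubQuot.mk_eq_zero_iff F (hQP hx)).2 hx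
  obtain ⟨C, hC⟩ := Submodule.exists_isCompl (LinearMap.ker g)
  exact ⟨(Submodule.prodEquivOfIsCompl _ _ hC).symm ≪≫ₗ LinearEquiv.prodComm F _ _ ≪≫ₗ
    ((Submodule.quotientEquivOfIsCompl _ _ hC).symm ≪≫ₗ g.quotKerEquivOfSurjective hg).prodCongr
      (LinearEquiv.ofEq _ _ hfg ≪≫ₗ (LinearEquiv.ofInjective f hf).symm)⟩

variable {F : Type u} [Field F] {L : Type v} [LieRing L] [LieAlgebra F L]
  {H : Type v'} [LieRing H] [LieAlgebra F H]

theorem nonempty_grLieComp_equiv (e : GrLie F L ≃ₗ⁅F⁆ GrLie F H)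
    (he : ∀ i : ℕ+, (GrLie.degree F L i).map (e : GrLie F L →ₗ[F] _) = GrLie.degree F H i)
    (i : ℕ+) : Nonempty (GrLieComp F L i ≃ₗ[F] GrLieComp F H i) :=
  ⟨LinearEquiv.ofInjective (GrLie.incl F L i)
      (DirectSum.of_injective (β := GrLieComp F L) i) ≪≫ₗ
    e.toLinearEquiv.submoduleMap (GrLie.degree F L i) ≪≫ₗ
    LinearEquiv.ofEq _ _ (he i) ≪≫ₗ
    (LinearEquiv.ofInjective (GrLie.incl F H i)
      (DirectSum.of_injective (β := GrLieComp F H) i)).symm⟩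

/-- As a vector space, `γₙ/γₘ₊ₙ` is the direct sum of the components of `gr L` in degrees `n` to `m
+ n - 1`; these are split off one at a time. -/
theorem nonempty_gamma_subQuot_equiv
    (h : ∀ i : ℕ+, Nonempty (GrLieComp F L i ≃ₗ[F] GrLieComp F H i)) {n : ℕ} (hn : 1 ≤ n)
    (m : ℕ) :
    Nonempty (SubQuot (gamma F L n).toSubmodule (gamma F L (m + n)).toSubmodule ≃ₗ[F]
      SubQuot (gamma F H n).toSubmodule (gamma F H (m + n)).toSubmodule) := by
  induction m with
  | zero =>
    rw [zero_add]
    have := SubQuot.subsingleton_self (gamma F L n).toSubmodule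
    have := SubQuot.subsingleton_self (gamma F H n).toSubmodule
    exact ⟨LinearEquiv.ofSubsingleton _ _⟩
  | succ m ih =>
    obtain ⟨e₁⟩ := ih
    obtain ⟨e₂⟩ : Nonempty (SubQuot (gamma F L (m + n)).toSubmodule
        (gamma F L (m + n + 1)).toSubmodule ≃ₗ[F] SubQuot (gamma F H (m + n)).toSubmodule
        (gamma F H (m + n + 1)).toSubmodule) := h ⟨m + n, by omega⟩
    obtain ⟨e₃⟩ := SubQuot.nonempty_equiv_prod (gamma_anti F L (Nat.le_add_left n m))
      (gamma_anti F L (Nat.le_succ (m + n)))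
    obtain ⟨e₄⟩ := SubQuot.nonempty_equiv_prod (gamma_anti F H (Nat.le_add_left n m))
      (gamma_anti F H (Nat.le_succ (m + n)))
    rw [Nat.add_right_comm]
    exact ⟨e₃ ≪≫ₗ e₁.prodCongr e₂ ≪≫ₗ e₄.symm⟩

/-- For `m ≤ n`, `[γₙ, γₙ] ⊆ γₙ₊ₙ ⊆ γₘ₊ₙ`. This is where `n ≥ m` enters: between abelian Lie
algebras a linear isomorphism is enough. -/
theorem gammaQuot_lie_eq_zero {m n : ℕ} (hm : 1 ≤ m) (hmn : m ≤ n)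
    (x y : GammaQuot F L n (m + n)) : ⁅x, y⁆ = 0 := by
  obtain ⟨x, rfl⟩ := LieSubmodule.Quotient.surjective_mk' _ x
  obtain ⟨y, rfl⟩ := LieSubmodule.Quotient.surjective_mk' _ y
  refine (LieSubmodule.Quotient.mk_eq_zero' (m := ⁅x, y⁆)).2 ?_
  exact gamma_anti F L (Nat.add_le_add_right hmn n)
    (lie_mem_gamma F L (hm.trans hmn) (hm.trans hmn) x.2 y.2)

theorem nonempty_gammaQuot_equiv
    (h : ∀ i : ℕ+, Nonempty (GrLieComp F L i ≃ₗ[F] GrLieComp F H i)) {m n : ℕ} (hm : 1 ≤ m)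
    (hmn : m ≤ n) : Nonempty (GammaQuot F L n (m + n) ≃ₗ⁅F⁆ GammaQuot F H n (m + n)) := by
  obtain ⟨e⟩ := nonempty_gamma_subQuot_equiv h (hm.trans hmn) m
  -- The quotient by the Lie ideal and the quotient vector space unfold to the same module.
  let e' : GammaQuot F L n (m + n) ≃ₗ[F] GammaQuot F H n (m + n) := e
  exact ⟨{ e' with
    map_lie' := fun {x y} => by
      change e' ⁅x, y⁆ = ⁅e' x, e' y⁆
      rw [gammaQuot_lie_eq_zero hm hmn, gammaQuot_lie_eq_zero hm hmn, map_zero] }⟩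

end Quotients

end LieGraded

theorem mainTheorem1 {F : Type*} [Field F] {L : Type*} [LieRing L] [LieAlgebra F L] :
    -- `φ : U(gr L) → gr U(L)` is an isomorphism of graded associative algebras
    (Nonempty (GradedAlgebra (LieGraded.envDegree F L)) ∧
      Function.Bijective (LieGraded.phi F L) ∧
      ∀ n : ℕ, (LieGraded.envDegree F L n).map (LieGraded.phi F L).toLinearMap =
        LieGraded.GrEnv.degree F L n) ∧
    -- `gr L` and the quotients `γₙ(L) / γₘ₊ₙ(L)` are determined by `U(L)`
    ∀ {H : Type*} [LieRing H] [LieAlgebra F H],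
      Nonempty (UniversalEnvelopingAlgebra F L ≃ₐ[F] UniversalEnvelopingAlgebra F H) →
      (∃ e : LieGraded.GrLie F L ≃ₗ⁅F⁆ LieGraded.GrLie F H,
        ∀ i : ℕ+, (LieGraded.GrLie.degree F L i).map (e : LieGraded.GrLie F L →ₗ[F] _) =
          LieGraded.GrLie.degree F H i) ∧
      ∀ m n : ℕ, 1 ≤ m → m ≤ n →
        Nonempty (LieGraded.GammaQuot F L n (m + n) ≃ₗ⁅F⁆ LieGraded.GammaQuot F H n (m + n)) := by
  refine ⟨⟨LieGraded.nonempty_gradedAlgebra_envDegree F L,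
    ⟨LieGraded.phi_injective F L, LieGraded.phi_surjective F L⟩,
    LieGraded.map_phi_envDegree F L⟩, ?_⟩
  rintro H _ _ ⟨f⟩
  obtain ⟨e, he⟩ := LieGraded.exists_grLie_equiv f
  exact ⟨⟨e, he⟩, fun m n hm hmn => LieGraded.nonempty_gammaQuot_equiv
    (LieGraded.nonempty_grLieComp_equiv e he) hm hmn⟩
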